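/- Let $k$ be a number field, $\mathfrak p$ a finite prime of $k$, $k_{\mathfrak p}$ the completion with ring of integers $\mathcal O$, and let $m$ be a positive integer such that $k$ contains a primitive $m$-th root of unity; $\mu_m$ denotes the group of $m$-th roots of unity. Let $\mathbf G$ be a semisimple, simply connected group which is split over $k_{\mathfrak p}$, let $\mathbf T\cong\mathbb G_m^n$ be a maximal split torus over $k_{\mathfrak p}$, and put $\mathscr G=\mathbf G(k_{\mathfrak p})$, $\mathscr T=\mathbf T(k_{\mathfrak p})\cong (k_{\mathfrak p}^\times)^n$. Let $1\to\mu_m\to\tilde{\mathscr G}\to\mathscr G\to1$ be the canonical metaplectic extension over $k_{\mathfrak p}$, i.e. the central extension in which, for each root $\alpha$ that is long in its irreducible component, the canonical lifts $\tilde h_\alpha(t)$ (formed from the unique lifts of the root subgroups of $\pm\alpha$) of the elements $\alpha^\vee(t)$ satisfy $\tilde h_\alpha(t)\tilde h_\alpha(u)\tilde h_\alpha(tu)^{-1}=(t,u)_{\mathfrak p,m}$, the $m$-th power Hilbert symbol of $k_{\mathfrak p}$. Let $\tilde{\mathscr T}$ be the preimage of $\mathscr T$ in $\tilde{\mathscr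 G}$, and let $\mathscr Z\subseteq\mathscr T$ be the image of the centre of $\tilde{\mathscr T}$. A subgroup $\mathscr A$ with $\mathscr Z\subseteq\mathscr A\subseteq\mathscr T$ is called isotropic if its preimage in $\tilde{\mathscr T}$ is abelian. A maximal isotropic subgroup $\mathscr A$ is called tame if $\mathscr A=\mathscr Z\cdot\mathscr A_{\mathrm{tors}}$, where $\mathscr A_{\mathrm{tors}}$ is the torsion subgroup of $\mathscr A$. Theorem. If $\mathfrak p$ does not divide $m$, then there is a tame maximal isotropic subgroup of $\mathscr T$; in fact $\mathscr A=\mathscr Z\cdot(\mathcal O^\times)^n$ is one, where $(\mathcal O^\times)^n\subseteq\mathscr T$ is the subgroup of $\mathcal O$-integral points $\mathrm{Hom}(X^*(\mathbf T),\mathcal O^\times)$. -/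

import Mathlib

open scoped NumberField

instance adicCompletion_charZero {k : Type*} [Field k] [NumberField k]
    (v : IsDedekindDomain.HeightOneSpectrum (𝓞 k)) : CharZero (v.adicCompletion k) :=
  charZero_of_injective_algebraMap (algebraMap k (v.adicCompletion k)).injective

/-! ### The local Artin map and the Hilbert symbol -/

section HilbertSymbol

variable (F : Type*) [Field F]

/-- The maximal abelian extension `F^ab` of `F`: the compositum, inside an algebraic closure,
of all finite abelian extensions of `F`. -/
noncomputable def maxAbelianExtension : IntermediateField F (AlgebraicClosure F) :=
  ⨆ L : {L : IntermediateField F (AlgebraicClosure F) //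
    FiniteDimensional F L ∧ IsAbelianGalois F L}, L.1

variable {F}

/-- `θ : Fˣ → Gal(F^ab / F)` is the Artin map (norm residue map) of the nonarchimedean local field
`F` with valuation ring `O`.  By local class field theory there is exactly one
homomorphism such that
* every uniformizer `ϖ` acts on the maximal unramified extension, which is generated by the
  roots of unity of order prime to the residue characteristic, as the Frobenius `ζ ↦ ζ ^ q`,
  where `q` is the order of the residue field;
* for every finite extension `L / F` inside `F^ab`, norms from `L` act trivially on `L`. -/
structure IsLocalArtinMap (O : ValuationSubring F)
    (θ : Fˣ →* (maxAbelianExtension F ≃ₐ[F] maxAbelianExtension F)) : Prop where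
  frobenius : ∀ (ϖ : O) (ϖ' : Fˣ), Irreducible ϖ → (ϖ' : F) = (ϖ : F) →
    ∀ (n : ℕ) (ζ : maxAbelianExtension F),
      n.Coprime (Nat.card (IsLocalRing.ResidueField O)) → ζ ^ n = 1 →
        θ ϖ' ζ = ζ ^ Nat.card (IsLocalRing.ResidueField O)
  norm : ∀ L : IntermediateField F (maxAbelianExtension F), FiniteDimensional F L →
    ∀ (a : Fˣ) (y : L), Algebra.norm F y = (a : F) → ∀ x ∈ L, θ a x = x

/-- `c` is the `m`-th power Hilbert symbol `(a, b)_m = θ(a)(β) / β`, where `β ^ m = b`. -/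
def IsHilbertSymbol (O : ValuationSubring F) (m : ℕ) (c : Fˣ → Fˣ → rootsOfUnity m F) : Prop :=
  ∃ θ : Fˣ →* (maxAbelianExtension F ≃ₐ[F] maxAbelianExtension F), IsLocalArtinMap O θ ∧
    ∀ (a b : Fˣ) (β : maxAbelianExtension F),
      β ^ m = algebraMap F (maxAbelianExtension F) b →
        θ a β = (((c a b : Fˣ) : F)) • β

end HilbertSymbol

/-! ### The points of split semisimple groups, as Chevalley groups

`L` is a semisimple Lie algebra over a field `F` of characteristic zero, `H` is a splitting Cartan
subalgebra and `V` is a finite-dimensional representation of `L`. -/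

section Chevalley

open LieAlgebra LieAlgebra.IsKilling

/-- The exponential of a nilpotent endomorphism of a finite-dimensional space
(for `a` nilpotent all further terms of the exponential series vanish). -/
noncomputable def nilExp {F V : Type*} [Field F] [AddCommGroup V] [Module F V]
    (a : Module.End F V) : Module.End F V :=
  ∑ i ∈ Finset.range (Module.finrank F V + 1), ((Nat.factorial i : F))⁻¹ • a ^ i

variable {F : Type*} [Field F]
  {L : Type*} [LieRing L] [LieAlgebra F L]
  (H : LieSubalgebra F L) [LieRing.IsNilpotent H]
  (V : Type*) [AddCommGroup V] [Module F V] [LieRingModule L V] [LieModule F L V]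

/-- The character lattice: the group generated by the weights of `H` on `V`. -/
def weightLattice : AddSubgroup (Module.Dual F H) :=
  AddSubgroup.closure {φ | ∃ v : V, v ≠ 0 ∧ ∀ h : H, ⁅(h : L), v⁆ = φ h • v}

variable {V} in
/-- The invertible operator `g` acts on each weight space `V_φ` as the scalar `χ φ`. -/
def ActsThrough (χ : Multiplicative (weightLattice H V) →* Fˣ) (g : (Module.End F V)ˣ) : Prop :=
  ∀ (φ : weightLattice H V) (v : V), (∀ h : H, ⁅(h : L), v⁆ = φ.1 h • v) →
    (g : Module.End F V) v = ((χ (Multiplicative.ofAdd φ) : Fˣ) : F) • v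

/-- The group `Hom(X, U)` of points of the split torus with character lattice
`X = weightLattice H V`, with values in a subgroup `U` of `Fˣ`, acting diagonally on `V`. -/
def torusPoints (U : Subgroup Fˣ) : Subgroup (Module.End F V)ˣ where
  carrier := {g | ∃ χ : Multiplicative (weightLattice H V) →* Fˣ,
    (∀ φ, χ φ ∈ U) ∧ ActsThrough H χ g}
  mul_mem' := by
    rintro a b ⟨χ, hχ, ha⟩ ⟨ψ, hψ, hb⟩
    refine ⟨χ * ψ, fun φ => U.mul_mem (hχ φ) (hψ φ), fun φ v hv => ?_⟩
    rw [Units.val_mul, Module.End.mul_apply, hb φ v hv, map_smul, ha φ v hv, smul_smul]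
    simp [mul_comm]
  one_mem' := ⟨1, fun _ => U.one_mem, fun φ v _ => by simp⟩
  inv_mem' := by
    rintro a ⟨χ, hχ, ha⟩
    refine ⟨χ⁻¹, fun φ => U.inv_mem (hχ φ), fun φ v hv => ?_⟩
    have h := congrArg (fun w => ((a⁻¹ : (Module.End F V)ˣ) : Module.End F V) w) (ha φ v hv)
    simp only [map_smul] at h
    rw [← Module.End.mul_apply, Units.inv_mul, Module.End.one_apply] at h
    rw [MonoidHom.inv_apply, Units.val_inv_eq_inv_val]
    conv_rhs => rw [h]
    rw [smul_smul, inv_mul_cancel₀ (Units.ne_zero _), one_smul]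

/-- The Chevalley group of `(L, H, V)`: the subgroup of `GL(V)` generated by the root subgroups
`exp (x)`, `x` in a root space of `L`. -/
def chevalleyGroup : Subgroup (Module.End F V)ˣ :=
  Subgroup.closure {g | ∃ α : H → F, α ≠ 0 ∧ ∃ x ∈ rootSpace H α,
    (g : Module.End F V) = nilExp (LieModule.toEnd F L V x)}

/-- The subgroup `T(U) = Hom(X, U)` of the Chevalley group, for a subgroup `U` of `Fˣ`.
The full maximal torus is the case `U = Fˣ`. -/
def chevalleyTorus (U : Subgroup Fˣ) : Subgroup (chevalleyGroup H V) :=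
  (torusPoints H V U).subgroupOf (chevalleyGroup H V)

variable [CharZero F] [IsKilling F L] [FiniteDimensional F L] [H.IsCartanSubalgebra]
  [LieModule.IsTriangularizable F H L]

/-- The algebraic group attached to `(L, H, V)` is simply connected: its character lattice is
the full lattice of integral weights, the dual of the coroot lattice. -/
def IsSimplyConnectedRep : Prop :=
  ∀ φ : Module.Dual F H, (∀ α : H.root, ∃ n : ℤ, φ ((rootSystem H).coroot α) = n) →
    φ ∈ weightLattice H V

/-- `α` is a long root of its irreducible component (every root is long in the simply-laced
case): `|⟨β, α^∨⟩| ≤ 1` for all roots `β ≠ ± α`. -/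
def IsLongRoot (α : H.root) : Prop :=
  ∀ β : H.root, (rootSystem H).root β ≠ (rootSystem H).root α →
    (rootSystem H).root β ≠ -(rootSystem H).root α → |(rootSystem H).pairingIn ℤ β α| ≤ 1

end Chevalley

/-! ### The canonical metaplectic extension -/

section Metaplectic

open LieAlgebra LieAlgebra.IsKilling

/-- `w(t) = x(t) y(-t⁻¹) x(t)`. -/
def weylElement {F E : Type*} [Field F] [Group E] (X Y : Multiplicative F →* E) (t : Fˣ) : E :=
  X (Multiplicative.ofAdd (t : F)) * Y (Multiplicative.ofAdd (-(t : F)⁻¹)) *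
    X (Multiplicative.ofAdd (t : F))

/-- `h(t) = w(t) w(-1)`. -/
def torusElement {F E : Type*} [Field F] [Group E] (X Y : Multiplicative F →* E) (t : Fˣ) : E :=
  weylElement X Y t * weylElement X Y (-1)

variable {F : Type*} [Field F]
  {L : Type*} [LieRing L] [LieAlgebra F L]
  (H : LieSubalgebra F L)

/-- `X` is a lift to `E` of the one-parameter subgroup `t ↦ exp (t x)`. -/
def IsRootLift [LieRing.IsNilpotent H]
    {V : Type*} [AddCommGroup V] [Module F V] [LieRingModule L V] [LieModule F L V]
    {μ E : Type*} [Group μ] [Group E] (S : GroupExtension μ E (chevalleyGroup H V))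
    (x : L) (X : Multiplicative F →* E) : Prop :=
  ∀ t : F, ((S.rightHom (X (Multiplicative.ofAdd t)) : (Module.End F V)ˣ) : Module.End F V) =
    nilExp (t • LieModule.toEnd F L V x)

/-- The canonical metaplectic extension of the (simply connected) Chevalley group by `μ`, for the
symbol `c`: the central extension with Steinberg cocycle
`h_α(t) h_α(u) h_α(tu)⁻¹ = c (t, u)` for each long root `α`.  Here `h_α` is formed in `E` from the
lifts of the root subgroups of `α` and `-α`; these lifts exist and are unique, because `F` is
a vector space over `ℚ` and `μ` is finite.  For a Hilbert symbol there is exactly one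
such extension up to isomorphism. -/
structure IsCanonicalExtension [CharZero F] [IsKilling F L] [FiniteDimensional F L]
    [H.IsCartanSubalgebra] [LieModule.IsTriangularizable F H L]
    {V : Type*} [AddCommGroup V] [Module F V] [LieRingModule L V] [LieModule F L V]
    {μ E : Type*} [Group μ] [Group E] (S : GroupExtension μ E (chevalleyGroup H V))
    (c : Fˣ → Fˣ → μ) : Prop where
  central : S.inl.range ≤ Subgroup.center E
  cocycle : ∀ α : H.root, IsLongRoot H α → ∀ h e f : L, IsSl2Triple h e f →
    e ∈ rootSpace H ((rootSystem H).root α) → f ∈ rootSpace H (-((rootSystem H).root α)) →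
    ∀ X Y : Multiplicative F →* E, IsRootLift H S e X → IsRootLift H S f Y →
    ∀ t u : Fˣ,
      torusElement X Y t * torusElement X Y u = S.inl (c t u) * torusElement X Y (t * u)

end Metaplectic

/-! ### Tame maximal isotropic subgroups -/

section Isotropic

variable {E G : Type*} [Group E] [Group G] (π : E →* G) (T : Subgroup G)

/-- The image in `T` of the centre of the preimage of `T` under `π`. -/
def centreImage : Subgroup G :=
  ((Subgroup.center (T.comap π)).map (T.comap π).subtype).map π

/-- `A` is an isotropic subgroup of `T`: it contains the image of the centre of the preimage
of `T`, and its preimage is commutative. -/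
structure IsIsotropic (A : Subgroup G) : Prop where
  centre_le : centreImage π T ≤ A
  le_torus : A ≤ T
  comm : ∀ x ∈ A.comap π, ∀ y ∈ A.comap π, x * y = y * x

/-- `A` is a maximal isotropic subgroup of `T`. -/
def IsMaximalIsotropic (A : Subgroup G) : Prop :=
  Maximal (IsIsotropic π T) A

/-- `A` is tame: it is the product of the image of the centre and the torsion of `A`. -/
def IsTame (A : Subgroup G) : Prop :=
  ∀ a ∈ A, ∃ z ∈ centreImage π T, ∃ b ∈ A, IsOfFinOrder b ∧ a = z * b

end Isotropic

/-! Everything is read off from commutators in the preimage of the torus. In the simply connected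
case the torus is the coroot lattice tensored with `Fˣ`, and the coroots of long roots already span
that lattice, so the lifts `h_α(t)` with `α` long generate the preimage modulo the central kernel
(`chevalleyTorus_eq_closure`). The commutator of `h_α(t)` and `h_β(u)` is `(t, u) ^ ⟨α, β^∨⟩`:
conjugation by `h_β(u)` rescales the lifted root subgroups of `±α`, hence turns `h_α(t)` into
`h_α(rt) h_α(r)⁻¹` with `r = u ^ ⟨α, β^∨⟩`, and the cocycle evaluates the discrepancy
(`torusElement_mul_eq`).

When the prime does not divide `m`, three facts about the symbol and the units suffice. The symbol
is trivial on pairs of units (`IsHilbertSymbol.apply_units`), so the integral points `T₀` have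
commutative preimage. Some unit `u₀` makes `(ϖ, u₀)` of exact order `m`
(`IsHilbertSymbol.exists_dvd_of_zpow_eq_one`). Every unit is a root of unity times an `m`-th power
(`ValuationSubring.exists_eq_mul_pow`).

For maximality, split a torus element as a part `q` built from powers of `ϖ` times a part in `T₀`.
If a lift commutes with all lifts from `T₀`, testing against `u₀` shows that `m` divides every
exponent in the commutators of `q`; these are then trivial, and `q` is central. For tameness, `m`-th
powers of lifts are central because the symbol is killed by `m`, so only roots of unity remain.
`TameCommutators` isolates this abstract argument.

The remaining work verifies its hypotheses. The formulas for `α^∨(t)` in an arbitrary representation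
rest on the integral diagonalizability of the coroots (`Sl2Relations.iSup_eigenspace_eq_top`); the
values of the symbol rest on Hensel's lemma, Kummer theory and the Frobenius property of the Artin
map. -/

/-! ### Representations of `sl₂` -/

/-- The relations `[h, e] = 2e`, `[h, f] = -2f`, `[e, f] = h` in an associative ring. -/
structure Sl2Relations {A : Type*} [Ring A] (h e f : A) : Prop where
  h_mul_e : h * e = e * (h + 2)
  h_mul_f : h * f = f * (h - 2)
  e_mul_f : e * f = f * e + h

namespace Sl2Relations

section Ring

variable {A : Type*} [Ring A] {h e f : A}

lemma symm (r : Sl2Relations h e f) : Sl2Relations (-h) f e where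
  h_mul_e := by rw [neg_mul, r.h_mul_f]; noncomm_ring
  h_mul_f := by rw [neg_mul, r.h_mul_e]; noncomm_ring
  e_mul_f := by rw [r.e_mul_f]; abel

lemma h_mul_e_pow (r : Sl2Relations h e f) (n : ℕ) : h * e ^ n = e ^ n * (h + 2 * n) := by
  induction n with
  | zero => simp
  | succ n ih =>
    have hc : (2 * n : A) * e = e * (2 * n) := by
      rw [mul_assoc, Nat.cast_comm, ← mul_assoc, ← mul_assoc, two_mul, mul_two]
    rw [pow_succ, ← mul_assoc, ih, mul_assoc, add_mul, r.h_mul_e, hc, mul_assoc, ← mul_add]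
    congr 2
    push_cast
    rw [mul_add, mul_one, add_assoc, add_comm 2]

lemma e_mul_f_pow_succ (r : Sl2Relations h e f) (n : ℕ) :
    e * f ^ (n + 1) = f ^ (n + 1) * e + (n + 1) * (f ^ n * (h - n)) := by
  induction n with
  | zero => simp [r.e_mul_f]
  | succ n ih =>
    have hc (x : A) : (n : A) * x = x * n := Nat.cast_comm n x
    rw [pow_succ f (n + 1), ← mul_assoc, ih, add_mul, mul_assoc, r.e_mul_f]
    have : ((n : A) + 1) * (f ^ n * (h - n)) * f =
        ((n : A) + 1) * (f ^ (n + 1) * (h - 2 - n)) := by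
      rw [mul_assoc, mul_assoc (f ^ n), sub_mul, r.h_mul_f, hc, ← mul_sub, ← mul_assoc (f ^ n) f,
        ← pow_succ]
    rw [this, mul_add, ← mul_assoc, ← pow_succ, add_assoc]
    congr 1
    push_cast
    simp only [add_mul, mul_add, mul_sub, one_mul, hc, mul_one, mul_assoc, mul_two]
    abel

end Ring

open Polynomial Module

variable {F V : Type*} [Field F] [AddCommGroup V] [Module F V]
  {h e f : Module.End F V}

/-- Each nonzero `e ^ n` is an eigenvector of `ad h` on `End V` with eigenvalue `2n`. In
characteristic zero these are distinct, and a finite-dimensional space allows only finitely many. -/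
lemma isNilpotent_e [CharZero F] [FiniteDimensional F V] (r : Sl2Relations h e f) :
    IsNilpotent e := by
  by_contra hn
  let D : Module.End F (Module.End F V) := LinearMap.mulLeft F h - LinearMap.mulRight F h
  have hD (n : ℕ) : D.HasEigenvalue (2 * n : F) := by
    refine Module.End.hasEigenvalue_of_hasEigenvector (x := e ^ n)
      ⟨Module.End.mem_eigenspace_iff.mpr ?_, fun h0 => hn ⟨n, h0⟩⟩
    simp only [D, LinearMap.sub_apply, LinearMap.mulLeft_apply, LinearMap.mulRight_apply,
      r.h_mul_e_pow]
    rw [mul_add, add_sub_cancel_left, mul_smul, Nat.cast_smul_eq_nsmul, ofNat_smul_eq_nsmul,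
      nsmul_eq_mul, nsmul_eq_mul, ← mul_assoc,
      show e ^ n * 2 = 2 * e ^ n from (Nat.cast_comm 2 _).symm,
      mul_assoc,
      ← Nat.cast_comm n]
    rfl
  refine Set.infinite_of_injective_forall_mem (f := fun n : ℕ => (2 * n : F)) (fun a b hab => ?_)
    hD (Module.End.finite_hasEigenvalue D)
  simpa using hab

lemma aeval_X_sub_C_apply (h : Module.End F V) (a : F) (v : V) :
    aeval h (X - C a) v = h v - a • v := by
  rw [map_sub, aeval_X, aeval_C, LinearMap.sub_apply, Module.algebraMap_end_apply]

lemma h_e_apply (r : Sl2Relations h e f) (v : V) : h (e v) = e (h v) + (2 : F) • e v := by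
  have h2 : (2 : Module.End F V) v = (2 : F) • v := by
    rw [ofNat_smul_eq_nsmul]; exact Module.End.natCast_apply 2 v
  rw [← Module.End.mul_apply, r.h_mul_e, Module.End.mul_apply, LinearMap.add_apply, h2, map_add,
    map_smul]

lemma h_f_apply (r : Sl2Relations h e f) (v : V) : h (f v) = f (h v) - (2 : F) • f v := by
  have := r.symm.h_e_apply v
  simp only [LinearMap.neg_apply, map_neg] at this
  rw [← neg_neg (h (f v)), this]
  module

lemma e_f_pow_succ_apply (r : Sl2Relations h e f) (n : ℕ) (v : V) :
    e ((f ^ (n + 1)) v) =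
      (f ^ (n + 1)) (e v) + ((n : F) + 1) • (f ^ n) (h v - (n : F) • v) := by
  rw [← Module.End.mul_apply, r.e_mul_f_pow_succ]
  simp [add_smul, Module.End.natCast_apply, add_mul, Nat.cast_smul_eq_nsmul]

/-- On a vector which is primitive modulo a submodule, the operator `e ^ n * f ^ n` acts as
`n! h (h - 1) ⋯ (h - n + 1)`. -/
lemma e_pow_f_pow_apply_sub_mem (r : Sl2Relations h e f) {W : Submodule F V}
    (hW : ∀ w ∈ W, h w ∈ W) (eW : ∀ w ∈ W, e w ∈ W) (fW : ∀ w ∈ W, f w ∈ W)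
    (n : ℕ) {v : V} (hv : e v ∈ W) :
    (e ^ n) ((f ^ n) v) -
      (n.factorial : F) • aeval h (∏ j ∈ Finset.range n, (X - C (j : F))) v ∈ W := by
  induction n generalizing v with
  | zero => simp
  | succ n ih =>
    have epow (k : ℕ) : ∀ w ∈ W, (e ^ k) w ∈ W := by
      induction k with
      | zero => simp
      | succ k ih => exact fun w hw => by rw [pow_succ, Module.End.mul_apply]; exact ih _ (eW w hw)
    have fpow (k : ℕ) : ∀ w ∈ W, (f ^ k) w ∈ W := by
      induction k with
      | zero => simp
      | succ k ih => exact fun w hw => by rw [pow_succ, Module.End.mul_apply]; exact ih _ (fW w hw)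
    -- Modulo `W`, `e f^(n+1) v` is `(n+1) f^n (h - n) v`, and `(h - n) v` is again primitive modulo
    -- `W`, so the induction hypothesis applies to it.
    have h2 : e (h v - (n : F) • v) ∈ W := by
      have : e (h v - (n : F) • v) = h (e v) - (2 + n : F) • e v := by
        rw [r.h_e_apply, map_sub, map_smul]; module
      rw [this]
      exact W.sub_mem (hW _ hv) (W.smul_mem _ hv)
    have h3 := W.add_mem (W.smul_mem ((n : F) + 1) (ih h2)) (epow n _ (fpow (n + 1) _ hv))
    convert! h3 using 1
    have h4 : aeval h (X - C (n : F)) v = h v - (n : F) • v :=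
      aeval_X_sub_C_apply h _ v
    rw [pow_succ e, Module.End.mul_apply, r.e_f_pow_succ_apply, Finset.prod_range_succ, map_mul,
      Module.End.mul_apply, h4, map_add, map_smul, Nat.factorial_succ]
    push_cast
    module

/-! ### Integral diagonalizability of `h` in finite dimension -/

section FiniteDimensional

variable [CharZero F] [FiniteDimensional F V]

lemma isNilpotent_f (r : Sl2Relations h e f) : IsNilpotent f := r.symm.isNilpotent_e

/-- Once `f ^ n = 0`, the identity for `e ^ n * f ^ n` becomes a polynomial equation for `h` modulo
`W` with simple integral roots. The bound `m ≤ n` serves to force a prescribed root to occur. -/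
lemma exists_aeval_mem (r : Sl2Relations h e f) {W : Submodule F V}
    (hW : ∀ w ∈ W, h w ∈ W) (eW : ∀ w ∈ W, e w ∈ W) (fW : ∀ w ∈ W, f w ∈ W) (m : ℕ) :
    ∃ n, m ≤ n ∧ ∀ v, e v ∈ W → aeval h (∏ j ∈ Finset.range n, (X - C (j : F))) v ∈ W := by
  obtain ⟨N, hN⟩ := r.isNilpotent_f
  refine ⟨N + m, by lia, fun v hv => ?_⟩
  have := r.e_pow_f_pow_apply_sub_mem hW eW fW (N + m) hv
  rwa [pow_add f, hN, zero_mul, LinearMap.zero_apply, map_zero, zero_sub, W.neg_mem_iff,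
    W.smul_mem_iff (by exact_mod_cast Nat.factorial_ne_zero _)] at this

/-- The polynomial annihilating `v` has `n` as a simple root. Applied to `(h - n) v`, an eigenvector
unless zero, the product of the other factors is a nonzero scalar, so there is no Jordan block. -/
lemma h_apply_of_e_apply_eq_zero (r : Sl2Relations h e f) (n : ℕ) {v : V} (hv : e v = 0)
    (hv2 : h (h v - (n : F) • v) = (n : F) • (h v - (n : F) • v)) : h v = (n : F) • v := by
  obtain ⟨N, hnN, hN⟩ := r.exists_aeval_mem (W := ⊥) (by simp) (by simp) (by simp) (n + 1)
  specialize hN v (by simpa)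
  rw [← sub_eq_zero]
  by_contra hw
  rw [← Finset.prod_erase_mul _ _ (Finset.mem_range.mpr hnN), map_mul, Module.End.mul_apply] at hN
  have h4 : aeval h (X - C (n : F)) v = h v - (n : F) • v :=
      aeval_X_sub_C_apply h _ v
  rw [h4, Module.End.aeval_apply_of_hasEigenvector
    (⟨Module.End.mem_eigenspace_iff.mpr hv2, hw⟩ : h.HasEigenvector _ _), Submodule.mem_bot,
    smul_eq_zero, or_iff_left hw, eval_prod, Finset.prod_eq_zero_iff] at hN
  obtain ⟨j, hj, hj0⟩ := hN
  simp [sub_eq_zero] at hj0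
  simp [hj0] at hj

/-- Take the last nonzero `e^k y`. The formula for `f e^(k+1) y` reduces to `0 = -(k+1)(n+1+k) e^k
y`, which is impossible. Thus `e f` is injective, hence bijective, on each eigenspace of positive
integral eigenvalue. -/
lemma eq_zero_of_e_f_apply_eq_zero (r : Sl2Relations h e f) (n : ℕ) {y : V}
    (hy : h y = ((n + 1 : ℕ) : F) • y) (hy0 : e (f y) = 0) : y = 0 := by
  obtain ⟨N, hN⟩ := r.isNilpotent_e
  by_contra hne
  obtain ⟨k, hk, hk0⟩ := Nat.exists_not_and_succ_of_not_zero_of_exists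
    (p := fun k => (e ^ k) y = 0) (by simpa) ⟨N, by simp [hN]⟩
  have := r.symm.e_f_pow_succ_apply k y
  rw [hk0, map_zero, pow_succ, Module.End.mul_apply, hy0, map_zero, zero_add, LinearMap.neg_apply,
    hy, ← neg_smul, ← sub_smul, map_smul, smul_smul, eq_comm, smul_eq_zero, or_iff_left hk,
    mul_eq_zero] at this
  rcases this with h0 | h0
  · exact Nat.cast_add_one_ne_zero k h0
  · have : ((n + 1 + k : ℕ) : F) = 0 := by push_cast at h0 ⊢; linear_combination -h0
    exact absurd (Nat.cast_eq_zero.mp this) (by lia)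

lemma exists_e_f_apply_eq (r : Sl2Relations h e f) (n : ℕ) {u : V}
    (hu : h u = ((n + 1 : ℕ) : F) • u) : ∃ y, h y = ((n + 1 : ℕ) : F) • y ∧ e (f y) = u := by
  let U := Module.End.eigenspace h ((n + 1 : ℕ) : F)
  have hU : ∀ y ∈ U, (e * f) y ∈ U := fun y hy => by
    rw [Module.End.mem_eigenspace_iff] at hy ⊢
    rw [Module.End.mul_apply, r.h_e_apply, r.h_f_apply, hy, map_sub, map_smul, map_smul, map_smul]
    module
  let g := (e * f).restrict hU
  have hg : Function.Injective g := by
    rw [← LinearMap.ker_eq_bot, LinearMap.ker_eq_bot']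
    intro y hy
    ext
    exact r.eq_zero_of_e_f_apply_eq_zero n (Module.End.mem_eigenspace_iff.mp y.2)
      (congrArg Subtype.val hy)
  obtain ⟨y, hy⟩ := LinearMap.injective_iff_surjective.mp hg
    ⟨u, Module.End.mem_eigenspace_iff.mpr hu⟩
  exact ⟨y, Module.End.mem_eigenspace_iff.mp y.2, congrArg Subtype.val hy⟩

/-- Reduction to the primitive case: by induction `e v` is a true eigenvector of eigenvalue `n + 2`,
so it equals `e f y` for some `y` of that eigenvalue, and `v` may be replaced by the primitive
vector `v - f y`. -/
lemma h_apply_of_e_pow_apply_eq_zero (r : Sl2Relations h e f) (k n : ℕ) {v : V}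
    (hv : (e ^ k) v = 0) (hv2 : h (h v - (n : F) • v) = (n : F) • (h v - (n : F) • v)) :
    h v = (n : F) • v := by
  induction k generalizing n v with
  | zero => rw [pow_zero, Module.End.one_apply] at hv; simp [hv]
  | succ k ih =>
    have hu : h (e v) = ((n + 2 : ℕ) : F) • e v := by
      refine ih (n + 2) (by rwa [← Module.End.mul_apply, ← pow_succ]) ?_
      have h1 : h (e v) - ((n + 2 : ℕ) : F) • e v = e (h v - (n : F) • v) := by
        rw [r.h_e_apply, map_sub, map_smul]; push_cast; module
      rw [h1, r.h_e_apply, hv2, map_smul]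
      push_cast
      module
    obtain ⟨y, hy, hyu⟩ := r.exists_e_f_apply_eq (n + 1) hu
    have hfy : h (f y) = (n : F) • f y := by
      rw [r.h_f_apply, hy, map_smul]; push_cast; module
    have := r.h_apply_of_e_apply_eq_zero n (v := v - f y) (by rw [map_sub, hyu, sub_self]) <| by
      have : h (v - f y) - (n : F) • (v - f y) = h v - (n : F) • v := by
        rw [map_sub, hfy]; module
      rw [this, hv2]
    rw [map_sub, hfy, smul_sub] at this
    exact sub_left_injective this

lemma h_apply_of_sq (r : Sl2Relations h e f) (n : ℤ) {v : V}
    (hv : h (h v - (n : F) • v) = (n : F) • (h v - (n : F) • v)) : h v = (n : F) • v := by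
  obtain ⟨n, rfl | rfl⟩ := n.eq_nat_or_neg
  · obtain ⟨N, hN⟩ := r.isNilpotent_e
    rw [Int.cast_natCast] at hv ⊢
    exact r.h_apply_of_e_pow_apply_eq_zero N n (by simp [hN]) hv
  · obtain ⟨N, hN⟩ := r.symm.isNilpotent_e
    have := r.symm.h_apply_of_e_pow_apply_eq_zero N n (v := v) (by simp [hN]) (by
      have h1 : (-h) v - (n : F) • v = -(h v - ((-n : ℤ) : F) • v) := by
        push_cast; rw [LinearMap.neg_apply]; module
      rw [h1, map_neg, LinearMap.neg_apply, hv]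
      push_cast
      module)
    push_cast
    rw [neg_smul, ← this, LinearMap.neg_apply, neg_neg]

/-- In a finite-dimensional representation of `sl₂` the operator `h` is diagonalizable with integral
eigenvalues. -/
theorem iSup_eigenspace_eq_top (r : Sl2Relations h e f) :
    ⨆ n : ℤ, Module.End.eigenspace h (n : F) = ⊤ := by
  set W := ⨆ n : ℤ, Module.End.eigenspace h (n : F) with hWdef
  have stable (g : Module.End F V) (k : ℤ)
      (hg : ∀ v, h (g v) = g (h v) + (k : F) • g v) : ∀ w ∈ W, g w ∈ W := by
    intro w hw
    suffices W ≤ W.comap g from this hw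
    refine iSup_le fun n v hv => ?_
    rw [Module.End.mem_eigenspace_iff] at hv
    refine Submodule.mem_iSup_of_mem (n + k) (Module.End.mem_eigenspace_iff.mpr ?_)
    rw [hg, hv, map_smul]
    push_cast
    module
  have hW := stable h 0 (by simp)
  have eW := stable e 2 (by simpa using r.h_e_apply)
  have fW := stable f (-2) (fun v => by rw [r.h_f_apply]; push_cast; module)
  have key (a : ℤ) (v : V) (hv : h v - (a : F) • v ∈ W) : v ∈ W := by
    -- `h - a` is invertible on the eigenspaces other than that of `a`. So `(h - a) v` can be
    -- corrected by some `(h - a) v'` with `v'` in `W` until it has eigenvalue `a`; then `v - v'` is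
    -- killed by `(h - a)²`, hence is an eigenvector.
    have hle : W ≤ Module.End.eigenspace h (a : F) ⊔ W.map (h - algebraMap F _ (a : F)) := by
      refine iSup_le fun b w hw => ?_
      by_cases hab : b = a
      · subst hab; exact Submodule.mem_sup_left hw
      · refine Submodule.mem_sup_right ⟨((b : F) - a)⁻¹ • w,
          W.smul_mem _ (Submodule.mem_iSup_of_mem b hw), ?_⟩
        have : (b : F) - a ≠ 0 := sub_ne_zero.mpr (by exact_mod_cast hab)
        rw [map_smul, LinearMap.sub_apply, Module.End.mem_eigenspace_iff.mp hw,
          Module.algebraMap_end_apply, ← sub_smul, smul_smul, inv_mul_cancel₀ this, one_smul]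
    obtain ⟨w, hw, _, ⟨v', hv', rfl⟩, hsum⟩ := Submodule.mem_sup.mp (hle hv)
    rw [Module.End.mem_eigenspace_iff] at hw
    have hw' : h (v - v') - (a : F) • (v - v') = w := by
      rw [LinearMap.sub_apply, Module.algebraMap_end_apply] at hsum
      rw [map_sub, smul_sub, sub_sub_sub_comm, ← hsum, add_sub_cancel_right]
    have := r.h_apply_of_sq a (v := v - v') (by rw [hw', hw])
    rw [← sub_add_cancel v v']
    exact W.add_mem (Submodule.mem_iSup_of_mem a (Module.End.mem_eigenspace_iff.mpr this)) hv'
  have key2 (n : ℕ) (v : V)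
      (hv : aeval h (∏ j ∈ Finset.range n, (X - C (j : F))) v ∈ W) : v ∈ W := by
    induction n generalizing v with
    | zero => simpa using hv
    | succ n ih =>
      rw [Finset.prod_range_succ, map_mul, Module.End.mul_apply] at hv
      exact key n v (by rw [Int.cast_natCast, ← aeval_X_sub_C_apply]; exact ih _ hv)
  obtain ⟨n, -, hn⟩ := r.exists_aeval_mem hW eW fW 0
  obtain ⟨N, hN⟩ := r.isNilpotent_e
  -- If `e v` lies in `W`, then `v` is primitive modulo `W`, a product of factors `h - j` sends it
  -- into `W`, and the factors are stripped one at a time.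
  have key3 (k : ℕ) (v : V) (hv : (e ^ k) v = 0) : v ∈ W := by
    induction k generalizing v with
    | zero => rw [pow_zero, Module.End.one_apply] at hv; rw [hv]; exact W.zero_mem
    | succ k ih =>
      exact key2 n v (hn v (ih (e v) (by rwa [← Module.End.mul_apply, ← pow_succ])))
  exact eq_top_iff.mpr fun v _ => key3 N v (by simp [hN])

end FiniteDimensional

end Sl2Relations

/-! ### Exponentials of nilpotent endomorphisms -/

section NilExp

open Module

variable {F V : Type*} [Field F] [AddCommGroup V] [Module F V]

@[simp] lemma nilExp_zero : nilExp (0 : Module.End F V) = 1 := by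
  rw [nilExp, Finset.sum_range_succ', Finset.sum_eq_zero fun i _ => by simp]
  simp

lemma mul_nilExp_of_semiconj {D a b : Module.End F V} (h : D * a = b * D) :
    D * nilExp a = nilExp b * D := by
  have h' : SemiconjBy D a b := h
  simp only [nilExp, Finset.mul_sum, Finset.sum_mul, mul_smul_comm, smul_mul_assoc]
  exact Finset.sum_congr rfl fun i _ => by rw [(h'.pow_right i).eq]

variable [FiniteDimensional F V]

lemma pow_finrank_eq_zero_of_isNilpotent {a : Module.End F V} (ha : IsNilpotent a) :
    a ^ finrank F V = 0 := by
  have := LinearMap.aeval_self_charpoly a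
  rwa [(LinearMap.isNilpotent_iff_charpoly a).mp ha, map_pow, Polynomial.aeval_X] at this

variable [CharZero F]

lemma nilExp_eq_exp [Module ℚ (Module.End F V)] {a : Module.End F V} (ha : IsNilpotent a) :
    nilExp a = IsNilpotent.exp a := by
  have : a ^ (finrank F V + 1) = 0 := by
    rw [pow_succ, pow_finrank_eq_zero_of_isNilpotent ha, zero_mul]
  rw [IsNilpotent.exp_eq_sum this, nilExp]
  refine Finset.sum_congr rfl fun i _ => ?_
  rw [← Rat.cast_smul_eq_qsmul F]
  simp

lemma nilExp_add {a b : Module.End F V} (hab : Commute a b) (ha : IsNilpotent a)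
    (hb : IsNilpotent b) : nilExp (a + b) = nilExp a * nilExp b := by
  let _ : Module ℚ (Module.End F V) := Module.compHom _ (algebraMap ℚ F)
  rw [nilExp_eq_exp ha, nilExp_eq_exp hb, nilExp_eq_exp (hab.isNilpotent_add ha hb),
    IsNilpotent.exp_add_of_commute hab ha hb]

lemma nilExp_mul_nilExp_neg {a : Module.End F V} (ha : IsNilpotent a) :
    nilExp a * nilExp (-a) = 1 := by
  rw [← nilExp_add ((Commute.refl a).neg_right) ha ha.neg, add_neg_cancel, nilExp_zero]

/-- If `[x, a] = z`, `[z, a] = y` and `y` commutes with `a`, then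
`exp(-a) x exp(a) = x + z + y / 2`. -/
lemma mul_nilExp {a x y z : Module.End F V} (ha : IsNilpotent a) (hx : x * a = a * x + z)
    (hz : z * a = a * z + y) (hy : y * a = a * y) :
    x * nilExp a = nilExp a * (x + z + (2 : F)⁻¹ • y) := by
  obtain ⟨p, hp⟩ : ∃ p : ℕ → Module.End F V, p = fun i => ((i.factorial : F))⁻¹ • a ^ i := ⟨_, rfl⟩
  have hpa (i : ℕ) : p i * a = ((i : F) + 1) • p (i + 1) := by
    have h1 : ((i : F) + 1) ≠ 0 := by exact_mod_cast Nat.succ_ne_zero i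
    simp only [hp, smul_mul_assoc, ← pow_succ, smul_smul, Nat.factorial_succ]
    congr 1
    push_cast
    rw [mul_inv, ← mul_assoc, mul_inv_cancel₀ h1, one_mul]
  have hp0 : p 0 = 1 := by simp [hp]
  have step (k : ℕ) (u w : Module.End F V) (hu : x * p k = u) (hw : u * a = ((k : F) + 1) • w) :
      x * p (k + 1) = w := by
    have h1 : ((k : F) + 1) ≠ 0 := by exact_mod_cast Nat.succ_ne_zero k
    rw [← hu, mul_assoc, hpa, mul_smul_comm] at hw
    exact smul_right_injective _ h1 hw
  have h1 : x * p 1 = p 1 * x + p 0 * z := by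
    have e1 : p 1 = a := by simp [hp]
    rw [e1, hp0, one_mul, hx]
  have key (i : ℕ) : x * p (i + 2) = p (i + 2) * x + p (i + 1) * z + (2 : F)⁻¹ • (p i * y) := by
    induction i with
    | zero =>
      refine step 1 _ _ h1 ?_
      rw [add_mul, mul_assoc, hx, mul_assoc _ z, hz, mul_add, mul_add, ← mul_assoc, ← mul_assoc,
        hpa, hpa]
      simp only [smul_add, smul_mul_assoc]
      push_cast
      module
    | succ i ih =>
      refine step _ _ _ ih ?_
      rw [add_mul, add_mul, mul_assoc, hx, mul_assoc _ z, hz, smul_mul_assoc,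
        mul_assoc _ y, hy, mul_add, mul_add, ← mul_assoc, ← mul_assoc, ← mul_assoc, hpa, hpa, hpa]
      simp only [smul_add, smul_mul_assoc]
      push_cast
      module
  have hpz (k : ℕ) : p (finrank F V + k) = 0 := by
    rw [hp]
    simp only
    rw [pow_add, pow_finrank_eq_zero_of_isNilpotent ha, zero_mul, smul_zero]
  -- The terms vanish from index `finrank F V` on, so the window of summation may be shifted by one
  -- or two; this aligns the three sums in the recursion `key`.
  have s1 : nilExp a = ∑ i ∈ Finset.range (finrank F V + 1), p i := by rw [hp]; rfl
  have s2 : nilExp a = ∑ i ∈ Finset.range (finrank F V + 1), p (i + 1) + p 0 := by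
    rw [← Finset.sum_range_succ', Finset.sum_range_succ, hpz, add_zero, s1]
  have s3 : nilExp a = ∑ i ∈ Finset.range (finrank F V + 1), p (i + 2) + p 1 + p 0 := by
    rw [← Finset.sum_range_succ' (fun i => p (i + 1)), Finset.sum_range_succ,
      add_assoc (finrank F V), hpz,
      add_zero, s2]
  calc x * nilExp a = ∑ i ∈ Finset.range (finrank F V + 1), x * p (i + 2) + x * p 1 + x * p 0 := by
        rw [s3, mul_add, mul_add, Finset.mul_sum]
    _ = nilExp a * x + nilExp a * z + (2 : F)⁻¹ • (nilExp a * y) := by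
        nth_rw 1 [s3]
        nth_rw 1 [s2]
        rw [s1]
        simp only [key, h1, hp0, Finset.sum_add_distrib, add_mul, Finset.sum_mul, Finset.smul_sum,
          one_mul, mul_one]
        abel
    _ = nilExp a * (x + z + (2 : F)⁻¹ • y) := by rw [mul_add, mul_add, mul_smul_comm]

end NilExp

/-! ### Weyl elements and the action of `α^∨(t)` -/

section Weyl

open Module

variable {F V : Type*} [Field F] [AddCommGroup V] [Module F V]

/-- The operator `exp(t e) exp(-t⁻¹ f) exp(t e)`. -/
noncomputable def weylEnd (e f : Module.End F V) (t : F) : Module.End F V :=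
  nilExp (t • e) * nilExp ((-t⁻¹) • f) * nilExp (t • e)

/-- Lagrange interpolation on the finite spectrum realizes any function of the eigenvalue as a
polynomial in `h`. -/
lemma exists_end_apply_eq_smul [FiniteDimensional F V] (h : Module.End F V) (g : F → F) :
    ∃ D : Module.End F V, ∀ (μ : F) (v : V), h v = μ • v → D v = g μ • v := by
  classical
  let s := (Module.End.finite_hasEigenvalue h).toFinset
  refine ⟨Polynomial.aeval h (Lagrange.interpolate s id g), fun μ v hv => ?_⟩
  by_cases hv0 : v = 0
  · simp [hv0]
  have hev : h.HasEigenvector μ v := ⟨Module.End.mem_eigenspace_iff.mpr hv, hv0⟩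
  rw [Module.End.aeval_apply_of_hasEigenvector hev]
  congr 1
  exact Lagrange.eval_interpolate_at_node (v := id) g (Set.injOn_id _)
    ((Set.Finite.mem_toFinset _).mpr (Module.End.hasEigenvalue_of_hasEigenvector hev))

namespace Sl2Relations

variable [FiniteDimensional F V] [CharZero F] {h e f : Module.End F V}

/-- Moving `h` past the three exponentials gives `h`, then `h + 2t e`, then `-h + 2t e`, then `-h`:
the Weyl element induces the reflection. -/
lemma h_mul_weylEnd (r : Sl2Relations h e f) {t : F} (ht : t ≠ 0) :
    h * weylEnd e f t = -(weylEnd e f t * h) := by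
  have he : h * e = e * h + (2 : F) • e := LinearMap.ext fun v => r.h_e_apply v
  have hf : h * f = f * h - (2 : F) • f := LinearMap.ext fun v => r.h_f_apply v
  have ne : IsNilpotent (t • e) := r.isNilpotent_e.smul t
  have nf : IsNilpotent ((-t⁻¹) • f) := r.isNilpotent_f.smul _
  have h1 : h * nilExp (t • e) = nilExp (t • e) * (h + (2 * t) • e) := by
    rw [mul_nilExp (z := (2 * t) • e) (y := 0) ne]
    · simp
    · rw [mul_smul_comm, he, smul_mul_assoc]; module
    · simp only [smul_mul_assoc, mul_smul_comm]; module
    · simp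
  have h2 : h * nilExp ((-t⁻¹) • f) = nilExp ((-t⁻¹) • f) * (h + (2 * t⁻¹) • f) := by
    rw [mul_nilExp (z := (2 * t⁻¹) • f) (y := 0) nf]
    · simp
    · rw [mul_smul_comm, hf, smul_mul_assoc]; module
    · simp only [smul_mul_assoc, mul_smul_comm]; module
    · simp
  have h3 : e * nilExp ((-t⁻¹) • f) =
      nilExp ((-t⁻¹) • f) * (e - t⁻¹ • h - (t⁻¹ ^ 2) • f) := by
    rw [mul_nilExp (z := (-t⁻¹) • h) (y := (-2 * t⁻¹ ^ 2) • f) nf]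
    · congr 1
      rw [smul_smul]
      have : (2 : F)⁻¹ * (-2 * t⁻¹ ^ 2) = - t⁻¹ ^ 2 := by field_simp
      rw [this]
      module
    · rw [mul_smul_comm, r.e_mul_f, smul_mul_assoc]; module
    · simp only [smul_mul_assoc, mul_smul_comm, hf]; module
    · rw [smul_mul_smul_comm, smul_mul_smul_comm, mul_comm (-t⁻¹)]
  have h4 : (h + (2 * t) • e) * nilExp ((-t⁻¹) • f) =
      nilExp ((-t⁻¹) • f) * (-h + (2 * t) • e) := by
    rw [add_mul, smul_mul_assoc, h2, h3, ← mul_smul_comm, ← mul_add]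
    congr 1
    have e1 : 2 * t * t⁻¹ = 2 := by field_simp
    have e2 : 2 * t * t⁻¹ ^ 2 = 2 * t⁻¹ := by field_simp
    simp only [smul_sub, smul_smul, e1, e2]
    module
  have h5 : (-h + (2 * t) • e) * nilExp (t • e) = nilExp (t • e) * (-h) := by
    have : e * nilExp (t • e) = nilExp (t • e) * e :=
      mul_nilExp_of_semiconj (by rw [mul_smul_comm, smul_mul_assoc])
    rw [add_mul, neg_mul, h1, smul_mul_assoc, this, ← mul_smul_comm, ← mul_neg, ← mul_add]
    congr 1
    module
  rw [weylEnd, ← mul_assoc, ← mul_assoc, h1, mul_assoc _ _ (nilExp ((-t⁻¹) • f)), h4,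
    mul_assoc _ _ (nilExp (t • e)), mul_assoc _ _ (nilExp (t • e)), h5]
  simp only [mul_neg, mul_assoc]

lemma weylEnd_mul_weylEnd_neg (r : Sl2Relations h e f) (t : F) :
    weylEnd e f t * weylEnd e f (-t) = 1 := by
  have ne : nilExp (t • e) * nilExp ((-t) • e) = 1 := by
    rw [neg_smul]; exact nilExp_mul_nilExp_neg (r.isNilpotent_e.smul t)
  have nf : nilExp ((-t⁻¹) • f) * nilExp ((-(-t)⁻¹) • f) = 1 := by
    rw [inv_neg, neg_smul (-t⁻¹)]; exact nilExp_mul_nilExp_neg (r.isNilpotent_f.smul _)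
  calc _ = nilExp (t • e) * (nilExp ((-t⁻¹) • f) * (nilExp (t • e) * nilExp ((-t) • e)) *
        nilExp ((-(-t)⁻¹) • f)) * nilExp ((-t) • e) := by simp only [weylEnd, mul_assoc]
    _ = 1 := by rw [ne, mul_one, nf, mul_one, ne]

lemma ext_of_eigenspaces (r : Sl2Relations h e f) {A B : Module.End F V}
    (hAB : ∀ (n : ℤ) (v : V), h v = (n : F) • v → A v = B v) : A = B := by
  rw [← sub_eq_zero, ← LinearMap.ker_eq_top, eq_top_iff, ← r.iSup_eigenspace_eq_top]
  refine iSup_le fun n v hv => ?_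
  rw [LinearMap.mem_ker, LinearMap.sub_apply, hAB n v (Module.End.mem_eigenspace_iff.mp hv),
    sub_self]

lemma weylEnd_apply_eq_zpow_smul (r : Sl2Relations h e f) {t : F} (ht : t ≠ 0) {n : ℤ} {v : V}
    (hv : h v = (n : F) • v) : weylEnd e f t v = t ^ (-n) • weylEnd e f 1 v := by
  -- `D` plays the role of `t ^ (h/2)`, which would need a square root of `t`. Rounding `k / 2` down
  -- still scales `e` by `t` and `f` by `t⁻¹`, because these shift `k` by `±2`. The total exponent
  -- `⌊-n/2⌋ - ⌊n/2⌋` is `-n` in either parity.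
  obtain ⟨D, hD⟩ := exists_end_apply_eq_smul h
    (fun μ => t ^ (Function.invFun (fun n : ℤ => (n : F)) μ / 2))
  have hD' (k : ℤ) (w : V) (hw : h w = (k : F) • w) : D w = t ^ (k / 2) • w := by
    rw [hD _ _ hw]
    rw [Function.leftInverse_invFun (f := fun n : ℤ => (n : F)) Int.cast_injective k]
  have De : D * e = (t • e) * D := by
    refine r.ext_of_eigenspaces fun k w hw => ?_
    have h1 : h (e w) = ((k + 2 : ℤ) : F) • e w := by
      rw [r.h_e_apply, hw, map_smul]; push_cast; module
    rw [Module.End.mul_apply, Module.End.mul_apply, hD' _ _ h1, hD' _ _ hw,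
      Int.add_ediv_of_dvd_right (dvd_refl 2), LinearMap.smul_apply, map_smul, smul_smul,
      Int.ediv_self (by decide), zpow_add₀ ht, zpow_one, mul_comm]
  have Df : D * f = (t⁻¹ • f) * D := by
    refine r.ext_of_eigenspaces fun k w hw => ?_
    have h1 : h (f w) = ((k + -2 : ℤ) : F) • f w := by
      rw [r.h_f_apply, hw, map_smul]; push_cast; module
    rw [Module.End.mul_apply, Module.End.mul_apply, hD' _ _ h1, hD' _ _ hw,
      Int.add_ediv_of_dvd_right (by norm_num), LinearMap.smul_apply, map_smul, smul_smul,
      show (-2 : ℤ) / 2 = -1 by decide, zpow_add₀ ht, zpow_neg_one, mul_comm]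
  have DW : D * weylEnd e f 1 = weylEnd e f t * D := by
    have e1 : D * nilExp ((1 : F) • e) = nilExp (t • e) * D :=
      mul_nilExp_of_semiconj (by rw [one_smul, De])
    have e2 : D * nilExp ((-1⁻¹ : F) • f) = nilExp ((-t⁻¹) • f) * D := by
      refine mul_nilExp_of_semiconj ?_
      rw [mul_smul_comm, Df, neg_smul, smul_mul_assoc, smul_mul_assoc]
      simp
    rw [weylEnd, ← mul_assoc, ← mul_assoc, e1, mul_assoc _ D, e2, mul_assoc, mul_assoc _ D, e1]
    simp only [weylEnd, mul_assoc]
  have hW : h (weylEnd e f 1 v) = ((-n : ℤ) : F) • weylEnd e f 1 v := by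
    rw [← Module.End.mul_apply, r.h_mul_weylEnd one_ne_zero, LinearMap.neg_apply,
      Module.End.mul_apply, hv, map_smul]
    push_cast
    module
  have := congrArg (· v) DW
  simp only [Module.End.mul_apply] at this
  rw [hD' _ _ hW, hD' _ _ hv, map_smul] at this
  rw [← smul_right_injective V (zpow_ne_zero (n / 2) ht) |>.eq_iff]
  rw [← this, smul_smul, ← zpow_add₀ ht]
  congr 2
  lia

lemma weylEnd_mul_weylEnd_neg_one_apply (r : Sl2Relations h e f) {t : F} (ht : t ≠ 0) {n : ℤ}
    {v : V} (hv : h v = (n : F) • v) :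
    (weylEnd e f t * weylEnd e f (-1)) v = t ^ n • v := by
  have hW : h (weylEnd e f (-1) v) = ((-n : ℤ) : F) • weylEnd e f (-1) v := by
    rw [← Module.End.mul_apply, r.h_mul_weylEnd (neg_ne_zero.mpr one_ne_zero),
      LinearMap.neg_apply, Module.End.mul_apply, hv, map_smul]
    push_cast
    module
  rw [Module.End.mul_apply, r.weylEnd_apply_eq_zpow_smul ht hW, neg_neg, ← Module.End.mul_apply,
    r.weylEnd_mul_weylEnd_neg, Module.End.one_apply]

lemma weylEnd_mul_weylEnd_neg_one_semiconj (r : Sl2Relations h e f) {t : F} (ht : t ≠ 0) {n : ℤ}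
    {x : Module.End F V} (hx : h * x = x * h + (n : F) • x) :
    (weylEnd e f t * weylEnd e f (-1)) * x = (t ^ n • x) * (weylEnd e f t * weylEnd e f (-1)) := by
  refine r.ext_of_eigenspaces fun k w hw => ?_
  have h1 : h (x w) = ((k + n : ℤ) : F) • x w := by
    rw [← Module.End.mul_apply, hx, LinearMap.add_apply, Module.End.mul_apply, hw, map_smul,
      LinearMap.smul_apply]
    push_cast
    module
  rw [Module.End.mul_apply, r.weylEnd_mul_weylEnd_neg_one_apply ht h1, Module.End.mul_apply,
    r.weylEnd_mul_weylEnd_neg_one_apply ht hw, map_smul, LinearMap.smul_apply, smul_smul,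
    zpow_add₀ ht]

end Sl2Relations

end Weyl

/-! ### Central extensions by groups of finite exponent -/

section CentralExtension

variable {E G : Type*} [Group E] [Group G] {π : E →* G}

/-- Write `a` as a central element times `a' ^ m`, with `a'` over `s / m`. The commutator of `a'`
and `b` is central and killed by `m`, so `a' ^ m` commutes with `b`. -/
lemma commute_lift_of_divisible {F : Type*} [Field F] [CharZero F] {m : ℕ} (hm : m ≠ 0)
    (hcen : π.ker ≤ Subgroup.center E) (hexp : ∀ z ∈ π.ker, z ^ m = 1)
    (hsurj : Function.Surjective π) (φ : Multiplicative F →* G) {a b : E}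
    {s t : F} (ha : π a = φ (.ofAdd s)) (hb : π b = φ (.ofAdd t)) : a * b = b * a := by
  have hmF : (m : F) ≠ 0 := by exact_mod_cast hm
  obtain ⟨a', ha'⟩ := hsurj (φ (.ofAdd (s / m)))
  have hs : φ (.ofAdd s) = φ (.ofAdd (s / m)) ^ m := by
    rw [← map_pow, ← ofAdd_nsmul, nsmul_eq_mul, mul_div_cancel₀ _ hmF]
  have hz : a * (a' ^ m)⁻¹ ∈ π.ker := by
    rw [MonoidHom.mem_ker, map_mul, map_inv, map_pow, ha, ha', hs, mul_inv_cancel]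
  have hc : a' * b * a'⁻¹ * b⁻¹ ∈ π.ker := by
    rw [MonoidHom.mem_ker]
    simp only [map_mul, map_inv, ha', hb]
    rw [← map_mul, mul_comm, map_mul, mul_assoc (φ _), mul_inv_cancel, mul_one, mul_inv_cancel]
  have hconj : b⁻¹ * a' * b = (a' * b * a'⁻¹ * b⁻¹) * a' := by
    have := Subgroup.mem_center_iff.mp (hcen hc) a'
    rw [← this, ← mul_left_inj b⁻¹, ← mul_right_inj b]
    have h2 := Subgroup.mem_center_iff.mp (hcen hc) b
    calc b * (b⁻¹ * a' * b * b⁻¹) = a' := by group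
      _ = (a' * b * a'⁻¹ * b⁻¹) * b * a' * b⁻¹ := by group
      _ = b * (a' * (a' * b * a'⁻¹ * b⁻¹) * b⁻¹) := by rw [← h2, this]; group
  have hpow : b⁻¹ * a' ^ m * b = a' ^ m := by
    have h1 : b⁻¹ * a' ^ m * b = (b⁻¹ * a' * b) ^ m := by
      have := conj_pow (a := b⁻¹) (b := a') (i := m)
      rw [inv_inv] at this
      exact this.symm
    have h2 : Commute (a' * b * a'⁻¹ * b⁻¹) a' := (Subgroup.mem_center_iff.mp (hcen hc) a').symm
    rw [h1, hconj, h2.mul_pow, hexp _ hc, one_mul]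
  have hab : a' ^ m * b = b * a' ^ m := by
    rw [← mul_right_inj b⁻¹, ← mul_assoc, hpow]; group
  calc a * b = (a * (a' ^ m)⁻¹) * (a' ^ m * b) := by group
    _ = b * (a * (a' ^ m)⁻¹) * a' ^ m := by
      rw [hab, ← mul_assoc, Subgroup.mem_center_iff.mp (hcen hz) b]
    _ = b * a := by group

/-- The `m`-th power of a lift of `s / m` does not depend on the lift, since the ambiguity is
central and killed by `m`. Lifts commute with one another, so these powers multiply. -/
lemma exists_lift_of_divisible {F : Type*} [Field F] [CharZero F] {m : ℕ} (hm : m ≠ 0)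
    (hcen : π.ker ≤ Subgroup.center E) (hexp : ∀ z ∈ π.ker, z ^ m = 1)
    (hsurj : Function.Surjective π) (φ : Multiplicative F →* G) :
    ∃ X : Multiplicative F →* E, ∀ s, π (X s) = φ s := by
  have hmF : (m : F) ≠ 0 := by exact_mod_cast hm
  choose σ hσ using fun s : F => hsurj (φ (.ofAdd s))
  have hmul (s t : F) : σ (s + t) ^ m = σ s ^ m * σ t ^ m := by
    have hz : σ (s + t) * (σ s * σ t)⁻¹ ∈ π.ker := by
      rw [MonoidHom.mem_ker, map_mul, map_inv, map_mul, hσ, hσ, hσ, ofAdd_add, map_mul,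
        mul_inv_cancel]
    have hc : Commute (σ (s + t) * (σ s * σ t)⁻¹) (σ s * σ t) :=
      (Subgroup.mem_center_iff.mp (hcen hz) _).symm
    have hst : Commute (σ s) (σ t) := commute_lift_of_divisible hm hcen hexp hsurj φ (hσ s) (hσ t)
    calc σ (s + t) ^ m = (σ (s + t) * (σ s * σ t)⁻¹ * (σ s * σ t)) ^ m := by
          rw [inv_mul_cancel_right]
      _ = σ s ^ m * σ t ^ m := by rw [hc.mul_pow, hexp _ hz, one_mul, hst.mul_pow]
  refine ⟨{ toFun := fun s => σ (s.toAdd / m) ^ m, map_one' := ?_, map_mul' := fun s t => ?_ },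
    fun s => ?_⟩
  · have := hmul 0 0
    rw [add_zero, left_eq_mul] at this
    rw [toAdd_one, zero_div, this]
  · rw [toAdd_mul, add_div, hmul]
  · change π (σ (s.toAdd / m) ^ m) = φ s
    rw [map_pow, hσ, ← map_pow, ← ofAdd_nsmul, nsmul_eq_mul,
      mul_div_cancel₀ _ hmF, ofAdd_toAdd]

/-- Two lifts differ by central elements killed by `m`, and every element of the source is an `m`-th
power. -/
lemma lift_unique_of_divisible {F : Type*} [Field F] [CharZero F] {m : ℕ} (hm : m ≠ 0)
    (hcen : π.ker ≤ Subgroup.center E) (hexp : ∀ z ∈ π.ker, z ^ m = 1)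
    {X Y : Multiplicative F →* E} (hXY : ∀ s, π (X s) = π (Y s)) : X = Y := by
  have hmF : (m : F) ≠ 0 := by exact_mod_cast hm
  refine MonoidHom.ext fun s => ?_
  obtain ⟨t, rfl⟩ : ∃ t : Multiplicative F, t ^ m = s :=
    ⟨.ofAdd (s.toAdd / m), by
      rw [← ofAdd_nsmul, nsmul_eq_mul, mul_div_cancel₀ _ hmF, ofAdd_toAdd]⟩
  have hz : X t * (Y t)⁻¹ ∈ π.ker := by
    rw [MonoidHom.mem_ker, map_mul, map_inv, hXY, mul_inv_cancel]
  have hc : Commute (X t * (Y t)⁻¹) (Y t) := (Subgroup.mem_center_iff.mp (hcen hz) _).symm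
  calc X (t ^ m) = (X t * (Y t)⁻¹ * Y t) ^ m := by rw [inv_mul_cancel_right, map_pow]
    _ = Y (t ^ m) := by rw [hc.mul_pow, hexp _ hz, one_mul, map_pow]

end CentralExtension

/-! ### Maximal isotropic subgroups from commutator formulas -/

section MaximalIsotropic

variable {E G : Type*} [Group E] [Group G] {π : E →* G}

lemma exists_eq_mul_of_mem_sup {A B : Subgroup G} (hAB : ∀ a ∈ A, ∀ b ∈ B, a * b = b * a) {x : G}
    (hx : x ∈ A ⊔ B) : ∃ a ∈ A, ∃ b ∈ B, x = a * b := by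
  rw [Subgroup.sup_eq_closure] at hx
  induction hx using Subgroup.closure_induction with
  | mem x hx =>
    rcases hx with hx | hx
    · exact ⟨x, hx, 1, B.one_mem, (mul_one x).symm⟩
    · exact ⟨1, A.one_mem, x, hx, (one_mul x).symm⟩
  | one => exact ⟨1, A.one_mem, 1, B.one_mem, (mul_one 1).symm⟩
  | mul x y _ _ hx hy =>
    obtain ⟨a, ha, b, hb, rfl⟩ := hx
    obtain ⟨a', ha', b', hb', rfl⟩ := hy
    refine ⟨a * a', A.mul_mem ha ha', b * b', B.mul_mem hb hb', ?_⟩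
    rw [mul_assoc, ← mul_assoc b, ← hAB a' ha' b hb]
    simp only [mul_assoc]
  | inv x _ hx =>
    obtain ⟨a, ha, b, hb, rfl⟩ := hx
    exact ⟨a⁻¹, A.inv_mem ha, b⁻¹, B.inv_mem hb, by
      rw [mul_inv_rev, hAB _ (A.inv_mem ha) _ (B.inv_mem hb)]⟩

lemma exists_mem_closure_of_apply_mem {S : Set E} {x : E}
    (hx : π x ∈ Subgroup.closure (π '' S)) :
    ∃ s ∈ Subgroup.closure S, ∃ z ∈ π.ker, x = s * z := by
  rw [← MonoidHom.map_closure] at hx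
  obtain ⟨s, hs, hsx⟩ := hx
  exact ⟨s, hs, s⁻¹ * x, by rw [MonoidHom.mem_ker, map_mul, map_inv, hsx, inv_mul_cancel], by group⟩

lemma commute_of_mem_closure {S T : Set E} (hST : ∀ s ∈ S, ∀ t ∈ T, s * t = t * s) {x y : E}
    (hx : x ∈ Subgroup.closure S) (hy : y ∈ Subgroup.closure T) : x * y = y * x := by
  have h1 : T ⊆ Subgroup.centralizer S := fun t ht s hs => hST s hs t ht
  have h2 := (Subgroup.closure_le _).mpr h1 hy
  rw [← Subgroup.centralizer_closure] at h2
  exact h2 x hx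

/-- Elements `a i t` of a central extension, indexed by `i` and by a unit `t` of a discretely valued
field, whose commutators are given by a tame symbol `c`. -/
structure TameCommutators {I M : Type*} [CommGroup M] (π : E →* G) (T T₀ : Subgroup G)
    (a : I → M → E) (U : Subgroup M) (c : M → M → E) (n : I → I → ℤ) (m : ℕ) (ϖ u₀ : M) :
    Prop where
  surjective : Function.Surjective π
  ker_le_center : π.ker ≤ Subgroup.center E
  pow_eq_one : ∀ z ∈ π.ker, z ^ m = 1
  torus_eq : T = Subgroup.closure (π '' {x | ∃ i t, x = a i t})
  units_eq : T₀ = Subgroup.closure (π '' {x | ∃ i, ∃ t ∈ U, x = a i t})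
  map_mul : ∀ i t u, π (a i (t * u)) = π (a i t) * π (a i u)
  symbol_mem : ∀ t u, c t u ∈ π.ker
  comm : ∀ i j t u, a i t * a j u = c t u ^ n i j * (a j u * a i t)
  symbol_unit : ∀ t ∈ U, ∀ u ∈ U, c t u = 1
  exists_eq : ∀ t, ∃ k : ℤ, ∃ u ∈ U, t = ϖ ^ k * u
  unit_mem : u₀ ∈ U
  dvd_of_zpow_eq_one : ∀ k : ℤ, c ϖ u₀ ^ k = 1 → (m : ℤ) ∣ k
  exists_eq_mul_pow : ∀ u ∈ U, ∃ ζ ∈ U, ∃ w, IsOfFinOrder ζ ∧ u = ζ * w ^ m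

/-! ### The product of the central image with `T₀` is maximal isotropic and tame -/

namespace TameCommutators

variable {I M : Type*} [CommGroup M] {T T₀ : Subgroup G}
    {a : I → M → E} {U : Subgroup M} {c : M → M → E} {n : I → I → ℤ} {m : ℕ} {ϖ u₀ : M}

variable (H : TameCommutators π T T₀ a U c n m ϖ u₀)

include H

lemma a_mem (i : I) (t : M) : π (a i t) ∈ T := by
  rw [H.torus_eq]; exact Subgroup.subset_closure ⟨_, ⟨i, t, rfl⟩, rfl⟩

lemma a_mem_units (i : I) {t : M} (ht : t ∈ U) : π (a i t) ∈ T₀ := by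
  rw [H.units_eq]; exact Subgroup.subset_closure ⟨_, ⟨i, t, ht, rfl⟩, rfl⟩

lemma units_le : T₀ ≤ T := by
  rw [H.units_eq, Subgroup.closure_le]
  rintro _ ⟨_, ⟨i, t, -, rfl⟩, rfl⟩
  exact H.a_mem i t

lemma symbol_comm (k : ℤ) (t u : M) (x : E) : c t u ^ k * x = x * c t u ^ k :=
  (Subgroup.mem_center_iff.mp (Subgroup.zpow_mem _ (H.ker_le_center (H.symbol_mem t u)) k) x).symm

lemma torus_comm {x y : G} (hx : x ∈ T) (hy : y ∈ T) : x * y = y * x := by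
  rw [H.torus_eq] at hx hy
  refine commute_of_mem_closure ?_ hx hy
  rintro _ ⟨_, ⟨i, t, rfl⟩, rfl⟩ _ ⟨_, ⟨j, u, rfl⟩, rfl⟩
  have := MonoidHom.mem_ker.mp (Subgroup.zpow_mem _ (H.symbol_mem t u) (n i j))
  rw [← _root_.map_mul, H.comm, _root_.map_mul, this, one_mul, _root_.map_mul]

/-- The kernel is central and the `a j u` generate the torus modulo it, so centrality need only be
tested on these generators. -/
lemma mem_centreImage {q : E} (hq : π q ∈ T) (hcomm : ∀ j u, q * a j u = a j u * q) :
    π q ∈ centreImage π T := by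
  refine ⟨q, ⟨⟨q, hq⟩, ?_, rfl⟩, rfl⟩
  refine Subgroup.mem_center_iff.mpr fun ⟨y, hy⟩ => Subtype.ext ?_
  change y * q = q * y
  rw [Subgroup.mem_comap, H.torus_eq] at hy
  obtain ⟨s, hs, z, hz, rfl⟩ := exists_mem_closure_of_apply_mem hy
  have h1 : s * q = q * s := by
    refine commute_of_mem_closure (T := {q}) ?_ hs (Subgroup.mem_closure_singleton_self q)
    rintro _ ⟨i, t, rfl⟩ _ rfl
    exact (hcomm i t).symm
  have h2 := Subgroup.mem_center_iff.mp (H.ker_le_center hz) q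
  rw [mul_assoc, ← h2, ← mul_assoc, h1, mul_assoc]

omit H in
lemma exists_of_mem_centreImage {z : G} (hz : z ∈ centreImage π T) :
    ∃ q, π q = z ∧ z ∈ T ∧ ∀ y, π y ∈ T → q * y = y * q := by
  obtain ⟨_, ⟨⟨q, hqT⟩, hq, rfl⟩, rfl⟩ := hz
  exact ⟨q, rfl, hqT, fun y hy =>
    (congrArg Subtype.val (Subgroup.mem_center_iff.mp hq ⟨y, hy⟩)).symm⟩

omit H in
lemma centreImage_le : centreImage π T ≤ T := fun _ hz =>
  (exists_of_mem_centreImage hz).choose_spec.2.1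

lemma units_lift_comm {x y : E} (hx : π x ∈ T₀) (hy : π y ∈ T₀) : x * y = y * x := by
  rw [H.units_eq] at hx hy
  obtain ⟨s, hs, z, hz, rfl⟩ := exists_mem_closure_of_apply_mem hx
  obtain ⟨s', hs', z', hz', rfl⟩ := exists_mem_closure_of_apply_mem hy
  have h1 : s * s' = s' * s := by
    refine commute_of_mem_closure ?_ hs hs'
    rintro _ ⟨i, t, ht, rfl⟩ _ ⟨j, u, hu, rfl⟩
    rw [H.comm, H.symbol_unit t ht u hu, one_zpow, one_mul]
  have h2 := Subgroup.mem_center_iff.mp (H.ker_le_center hz)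
  have h3 := Subgroup.mem_center_iff.mp (H.ker_le_center hz')
  exact ((Commute.mul_right h1 (h3 s)).mul_left ((h2 (s' * z')).symm)).eq

/-- The elements of the preimage of the torus whose commutators are powers of `c ϖ u`. -/
def uniformizerLifts : Subgroup E where
  carrier := {q | π q ∈ T ∧ ∃ N : I → ℤ, ∀ j u, q * a j u = c ϖ u ^ N j * (a j u * q)}
  mul_mem' := by
    rintro q q' ⟨hq, N, hN⟩ ⟨hq', N', hN'⟩
    refine ⟨by rw [_root_.map_mul]; exact T.mul_mem hq hq', N + N', fun j u => ?_⟩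
    rw [mul_assoc, hN', ← mul_assoc, ← H.symbol_comm, mul_assoc, ← mul_assoc q, hN, Pi.add_apply,
      add_comm, zpow_add]
    simp only [mul_assoc]
  one_mem' := ⟨by rw [map_one]; exact T.one_mem, 0, fun j u => by simp⟩
  inv_mem' := by
    rintro q ⟨hq, N, hN⟩
    refine ⟨by rw [map_inv]; exact T.inv_mem hq, -N, fun j u => ?_⟩
    have h1 : a j u * q = c ϖ u ^ (-N j) * (q * a j u) := by
      rw [hN, ← mul_assoc, ← zpow_add, neg_add_cancel, zpow_zero, one_mul]
    rw [Pi.neg_apply, inv_mul_eq_iff_eq_mul, ← mul_assoc, ← H.symbol_comm, mul_assoc,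
      ← mul_assoc q, ← mul_assoc, ← h1, mul_inv_cancel_right]

lemma exists_of_mem_torus {x : G} (hx : x ∈ T) :
    ∃ q ∈ H.uniformizerLifts, ∃ τ ∈ T₀, x = π q * τ := by
  suffices T ≤ H.uniformizerLifts.map π ⊔ T₀ by
    obtain ⟨_, ⟨q, hq, rfl⟩, τ, hτ, rfl⟩ := exists_eq_mul_of_mem_sup (A := H.uniformizerLifts.map π)
      (by rintro _ ⟨q, hq, rfl⟩ b hb; exact H.torus_comm hq.1 (H.units_le hb)) (this hx)
    exact ⟨q, hq, τ, hτ, rfl⟩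
  refine H.torus_eq.trans_le ((Subgroup.closure_le _).mpr ?_)
  rintro _ ⟨_, ⟨i, t, rfl⟩, rfl⟩
  obtain ⟨k, u, hu, rfl⟩ := H.exists_eq t
  have hpow : π (a i (ϖ ^ k)) = π (a i ϖ) ^ k :=
      map_zpow (MonoidHom.mk' (fun t => π (a i t)) (H.map_mul i)) ϖ k
  rw [H.map_mul, hpow, ← map_zpow]
  refine Subgroup.mul_mem_sup (Subgroup.mem_map_of_mem _ (Subgroup.zpow_mem _ ?_ k))
    (H.a_mem_units i hu)
  exact ⟨H.a_mem i ϖ, n i, fun j u => H.comm i j ϖ u⟩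

/-- The heart of maximality. One exponent `N j` governs the commutators of `q` with `a j u` for all
`u` at once, so commuting with the single test element `a j u₀` forces `m ∣ N j` and makes all of
them trivial. -/
lemma mem_of_commute {x : E} (hx : π x ∈ T) (hcomm : ∀ y, π y ∈ T₀ → x * y = y * x) :
    ∃ z ∈ centreImage π T, ∃ τ ∈ T₀, π x = z * τ := by
  obtain ⟨q, ⟨hqT, N, hN⟩, τ, hτ, hxq⟩ := H.exists_of_mem_torus hx
  refine ⟨π q, H.mem_centreImage hqT fun j u => ?_, τ, hτ, hxq⟩
  have hy : π (q⁻¹ * x) ∈ T₀ := by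
    rw [_root_.map_mul, map_inv, hxq, inv_mul_cancel_left]; exact hτ
  have h1 : q * a j u₀ = a j u₀ * q := by
    have e1 := hcomm (a j u₀) (H.a_mem_units j H.unit_mem)
    have e2 := H.units_lift_comm hy (H.a_mem_units j H.unit_mem)
    have e3 : q = x * (q⁻¹ * x)⁻¹ := by group
    rw [e3]
    exact (Commute.mul_left e1 (Commute.inv_left e2)).eq
  have h2 : c ϖ u₀ ^ N j = 1 := by
    rw [hN] at h1
    exact mul_eq_right.mp h1
  obtain ⟨k, hk⟩ := H.dvd_of_zpow_eq_one _ h2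
  rw [hN, hk, zpow_mul, zpow_natCast, H.pow_eq_one _ (H.symbol_mem _ _), one_zpow, one_mul]

/-- Writing `u = ζ * w ^ m`, the element `a i w ^ m` is central because commutators with `a i w` are
central and killed by `m`, while `ζ` contributes a torsion element. -/
lemma exists_torsion {τ : G} (hτ : τ ∈ T₀) :
    ∃ z ∈ centreImage π T, ∃ b ∈ T₀, IsOfFinOrder b ∧ τ = z * b := by
  rw [H.units_eq] at hτ
  induction hτ using Subgroup.closure_induction with
  | mem τ hτ =>
    obtain ⟨_, ⟨i, u, hu, rfl⟩, rfl⟩ := hτ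
    obtain ⟨ζ, hζ, w, hfin, rfl⟩ := H.exists_eq_mul_pow u hu
    have hpow (t : M) (k : ℕ) : π (a i (t ^ k)) = π (a i t) ^ k :=
      map_pow (MonoidHom.mk' (fun t => π (a i t)) (H.map_mul i)) t k
    have hone : π (a i 1) = 1 := map_one (MonoidHom.mk' (fun t => π (a i t)) (H.map_mul i))
    refine ⟨π (a i w ^ m), H.mem_centreImage ?_ fun j u => ?_, π (a i ζ), H.a_mem_units i hζ, ?_,
      ?_⟩
    · rw [map_pow]; exact T.pow_mem (H.a_mem i w) m
    · have hcom : a i w * a j u * (a i w)⁻¹ = c w u ^ n i j * a j u := by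
        rw [H.comm]; group
      have h1 : SemiconjBy (a j u)⁻¹ (a i w) (c w u ^ n i j * a i w) := by
        rw [SemiconjBy, inv_mul_eq_iff_eq_mul, ← mul_assoc, ← mul_assoc, ← H.symbol_comm,
          mul_assoc _ (a j u), ← H.comm, mul_inv_cancel_right]
      have h2 := h1.pow_right m
      rw [Commute.mul_pow (H.symbol_comm _ _ _ _), H.pow_eq_one _
        (Subgroup.zpow_mem _ (H.symbol_mem w u) _), one_mul] at h2
      exact (Commute.inv_left_iff.mp h2).eq.symm
    · obtain ⟨k, hk, hζk⟩ := isOfFinOrder_iff_pow_eq_one.mp hfin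
      exact isOfFinOrder_iff_pow_eq_one.mpr ⟨k, hk, by rw [← hpow, hζk, hone]⟩
    · rw [H.map_mul, hpow, map_pow]
      exact H.torus_comm (H.a_mem i ζ) (T.pow_mem (H.a_mem i w) m)
  | one => exact ⟨1, Subgroup.one_mem _, 1, Subgroup.one_mem _, IsOfFinOrder.one, (one_mul 1).symm⟩
  | mul x y _ _ hx hy =>
    obtain ⟨z, hz, b, hb, hfin, rfl⟩ := hx
    obtain ⟨z', hz', b', hb', hfin', rfl⟩ := hy
    have hc : Commute b b' := H.torus_comm (H.units_le hb) (H.units_le hb')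
    have h1 : b * z' = z' * b := H.torus_comm (H.units_le hb) (centreImage_le hz')
    refine ⟨z * z', Subgroup.mul_mem _ hz hz', b * b', Subgroup.mul_mem _ hb hb',
      hc.isOfFinOrder_mul hfin hfin', ?_⟩
    rw [mul_assoc, ← mul_assoc b, h1]
    simp only [mul_assoc]
  | inv x _ hx =>
    obtain ⟨z, hz, b, hb, hfin, rfl⟩ := hx
    exact ⟨z⁻¹, Subgroup.inv_mem _ hz, b⁻¹, Subgroup.inv_mem _ hb, hfin.inv, by
      rw [← mul_inv_rev, H.torus_comm (centreImage_le hz) (H.units_le hb)]⟩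

lemma exists_of_mem_sup {x : G} (hx : x ∈ centreImage π T ⊔ T₀) :
    ∃ z ∈ centreImage π T, ∃ τ ∈ T₀, x = z * τ :=
  exists_eq_mul_of_mem_sup (fun _ ha _ hb => H.torus_comm (centreImage_le ha) (H.units_le hb)) hx

lemma isIsotropic : IsIsotropic π T (centreImage π T ⊔ T₀) where
  centre_le := le_sup_left
  le_torus := sup_le centreImage_le H.units_le
  comm x hx y hy := by
    obtain ⟨_, hz, τ, hτ, hx'⟩ := H.exists_of_mem_sup hx
    obtain ⟨_, hz', τ', hτ', hy'⟩ := H.exists_of_mem_sup hy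
    obtain ⟨q, rfl, hqT, hq⟩ := exists_of_mem_centreImage hz
    obtain ⟨q', rfl, hqT', hq'⟩ := exists_of_mem_centreImage hz'
    have hyT : π y ∈ T := sup_le centreImage_le H.units_le hy
    have h1 : π (q⁻¹ * x) ∈ T₀ := by rwa [_root_.map_mul, map_inv, hx', inv_mul_cancel_left]
    have h2 : π (q'⁻¹ * y) ∈ T₀ := by rwa [_root_.map_mul, map_inv, hy', inv_mul_cancel_left]
    have h3 : Commute (q⁻¹ * x) (q'⁻¹ * y) := H.units_lift_comm h1 h2
    have h4 : Commute (q⁻¹ * x) q' := (hq' _ (H.units_le h1)).symm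
    have h5 : Commute (q⁻¹ * x) y := by simpa using h4.mul_right h3
    have h6 : Commute q y := hq y hyT
    simpa using (h6.mul_left h5).eq

lemma isMaximalIsotropic : IsMaximalIsotropic π T (centreImage π T ⊔ T₀) := by
  refine ⟨H.isIsotropic, fun B hB hle g hg => ?_⟩
  obtain ⟨x, rfl⟩ := H.surjective g
  obtain ⟨z, hz, τ, hτ, hx⟩ := H.mem_of_commute (hB.le_torus hg) fun y hy =>
    hB.comm x hg y (hle (Subgroup.mem_sup_right hy))
  rw [hx]
  exact Subgroup.mul_mem_sup hz hτ

lemma isTame : IsTame π T (centreImage π T ⊔ T₀) := by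
  intro x hx
  obtain ⟨z, hz, τ, hτ, rfl⟩ := H.exists_of_mem_sup hx
  obtain ⟨z', hz', b, hb, hfin, rfl⟩ := H.exists_torsion hτ
  exact ⟨z * z', Subgroup.mul_mem _ hz hz', b, Subgroup.mem_sup_right hb, hfin,
    (mul_assoc _ _ _).symm⟩

end TameCommutators

end MaximalIsotropic

/-! ### Coroots of long roots -/

section LongRoots

variable {ι R M N : Type*} [Finite ι] [CommRing R] [CharZero R] [IsDomain R] [AddCommGroup M]
  [Module R M] [AddCommGroup N] [Module R N] (P : RootPairing ι R M N) [P.IsCrystallographic]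
  [P.IsReduced]

/-- The coroots of the long roots span the coroot lattice. -/
lemma RootPairing.coroot_mem_span_coroot_long (i : ι) :
    P.coroot i ∈ Submodule.span ℤ {y | ∃ j, (∀ k, P.root k ≠ P.root j → P.root k ≠ -P.root j →
      |P.pairingIn ℤ k j| ≤ 1) ∧ y = P.coroot j} := by
  have := Fintype.ofFinite ι
  let B := P.posRootForm ℤ
  have : IsTrans ι fun a b => B.rootLength b < B.rootLength a := ⟨fun _ _ _ h h' => h'.trans h⟩
  have : Std.Irrefl fun a b : ι => B.rootLength b < B.rootLength a := ⟨fun _ => lt_irrefl _⟩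
  -- The induction runs from longer roots to shorter ones.
  induction i using (Finite.wellFounded_of_trans_of_irrefl
    (fun a b : ι => B.rootLength b < B.rootLength a)).induction with | _ i ih
  by_cases hi : ∀ k, P.root k ≠ P.root i → P.root k ≠ -P.root i → |P.pairingIn ℤ k i| ≤ 1
  · exact Submodule.subset_span ⟨i, hi, rfl⟩
  push Not at hi
  obtain ⟨j, hj, hj', hji⟩ := hi
  have hmem := P.pairingIn_pairingIn_mem_set_of_isCrystal_of_isRed' _ _ hj hj'
  have hnot : P.pairingIn ℤ j i ∉ ({-1, 0, 1} : Set ℤ) := by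
    rintro (h | h | h) <;> simp_all
  have hij : P.pairingIn ℤ i j = 1 ∨ P.pairingIn ℤ i j = -1 := by
    simp only [Set.mem_insert_iff, Set.mem_singleton_iff, Prod.mk.injEq] at hmem
    simp only [Set.mem_insert_iff, Set.mem_singleton_iff, not_or] at hnot
    lia
  -- If `i` is not long, some root `j` is strictly longer with `⟨i, j^∨⟩ = ±1`. Its reflection `k`
  -- in `i` is equally long, and the coroots of `j` and `k` differ by `±` the coroot of `i`.
  set k := P.reflectionPerm i j with hk
  have hkroot : P.root j = P.reflection i (P.root k) := by
    rw [hk, P.root_reflectionPerm, RootPairing.reflection_same]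
  have hki : P.root k ≠ P.root i := fun h => hj' (by rw [hkroot, h, P.reflection_apply_self])
  have hki' : P.root k ≠ -P.root i := fun h => hj (by
    rw [hkroot, h, map_neg, P.reflection_apply_self, neg_neg])
  have hkpair : P.pairingIn ℤ k i ∉ ({-1, 0, 1} : Set ℤ) := by
    have : P.pairingIn ℤ k i = -P.pairingIn ℤ j i := by
      apply FaithfulSMul.algebraMap_injective ℤ R
      rw [map_neg, P.algebraMap_pairingIn, P.algebraMap_pairingIn]
      rw [hk, ← P.pairing_reflectionPerm, P.pairing_reflectionPerm_self_right]
    rw [this]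
    simp only [Set.mem_insert_iff, Set.mem_singleton_iff] at hnot ⊢
    lia
  have ihj := ih j (B.rootLength_lt_of_pairingIn_notMem hj hj' hnot)
  have ihk := ih k (B.rootLength_lt_of_pairingIn_notMem hki hki' hkpair)
  have hco : P.coroot k = P.coroot j - P.pairingIn ℤ i j • P.coroot i := by
    rw [hk, P.coroot_reflectionPerm, P.coreflection_apply, ← Int.cast_smul_eq_zsmul R]
    congr 2
    exact (P.algebraMap_pairingIn ℤ i j).symm
  rcases hij with h | h
  · have : P.coroot i = P.coroot j - P.coroot k := by rw [hco, h]; module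
    rw [this]
    exact Submodule.sub_mem _ ihj ihk
  · have : P.coroot i = P.coroot k - P.coroot j := by rw [hco, h]; module
    rw [this]
    exact Submodule.sub_mem _ ihk ihj

end LongRoots

/-! ### Weights of representations of split semisimple Lie algebras -/

namespace Sl2Relations

open Module

variable {F V : Type*} [Field F] [CharZero F] [AddCommGroup V] [Module F V] [FiniteDimensional F V]
  {h e f : Module.End F V}

/-- The interpolating operator selecting the eigenvalue `μ` vanishes on all integral eigenspaces,
hence everywhere, if `μ` is not an integer. -/
lemma exists_int_of_apply_eq_smul (r : Sl2Relations h e f) {μ : F} {v : V} (hv : h v = μ • v)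
    (hv0 : v ≠ 0) : ∃ n : ℤ, μ = n := by
  classical
  by_contra hμ
  obtain ⟨D, hD⟩ := exists_end_apply_eq_smul h (fun x => if x = μ then 1 else 0)
  have : D = 0 := r.ext_of_eigenspaces fun n w hw => by
    rw [hD _ _ hw, if_neg fun h => hμ ⟨n, h.symm⟩, zero_smul, LinearMap.zero_apply]
  have h1 := hD _ _ hv
  rw [this, if_pos rfl, one_smul, LinearMap.zero_apply] at h1
  exact hv0 h1.symm

lemma maxGenEigenspace_eq_eigenspace (r : Sl2Relations h e f) (μ : F) :
    h.maxGenEigenspace μ = h.eigenspace μ := by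
  classical
  let s := (Module.End.finite_hasEigenvalue h).toFinset
  have hs : Polynomial.aeval h (∏ x ∈ s, (Polynomial.X - Polynomial.C x)) = 0 :=
    r.ext_of_eigenspaces fun n w hw => by
      by_cases hw0 : w = 0
      · simp [hw0]
      have hev : h.HasEigenvector (n : F) w := ⟨Module.End.mem_eigenspace_iff.mpr hw, hw0⟩
      have hns : (n : F) ∈ s :=
        (Set.Finite.mem_toFinset _).mpr (Module.End.hasEigenvalue_of_hasEigenvector hev)
      rw [Module.End.aeval_apply_of_hasEigenvector hev, Polynomial.eval_prod,
        Finset.prod_eq_zero hns (by simp), zero_smul, LinearMap.zero_apply]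
  have hsq : Squarefree (∏ x ∈ s, (Polynomial.X - Polynomial.C x)) :=
    (Polynomial.separable_prod_X_sub_C_iff' (f := fun x : F => x)).mpr
      (fun _ _ _ _ h => h) |>.squarefree
  exact (Module.End.isSemisimple_of_squarefree_aeval_eq_zero hsq
    hs).isFinitelySemisimple.maxGenEigenspace_eq_eigenspace μ

end Sl2Relations

section Weights

open LieAlgebra LieAlgebra.IsKilling Module

variable {F : Type*} [Field F] {L : Type*} [LieRing L] [LieAlgebra F L]
  (V : Type*) [AddCommGroup V] [Module F V] [LieRingModule L V] [LieModule F L V]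

lemma IsSl2Triple.sl2Relations {h e f : L} (t : IsSl2Triple h e f) :
    Sl2Relations (LieModule.toEnd F L V h) (LieModule.toEnd F L V e) (LieModule.toEnd F L V f) where
  h_mul_e := by
    ext v
    have h2 : (2 : Module.End F V) v = (2 : ℕ) • v := Module.End.natCast_apply 2 v
    simp only [Module.End.mul_apply, LieModule.toEnd_apply_apply, LinearMap.add_apply, h2, lie_add]
    rw [leibniz_lie h, t.lie_h_e_nsmul, nsmul_lie, lie_nsmul, add_comm]
  h_mul_f := by
    ext v
    have h2 : (2 : Module.End F V) v = (2 : ℕ) • v := Module.End.natCast_apply 2 v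
    simp only [Module.End.mul_apply, LieModule.toEnd_apply_apply, LinearMap.sub_apply, h2, lie_sub]
    rw [leibniz_lie h, t.lie_h_f_nsmul, neg_lie, nsmul_lie, lie_nsmul]
    abel
  e_mul_f := by
    ext v
    simp only [Module.End.mul_apply, LieModule.toEnd_apply_apply, LinearMap.add_apply]
    rw [leibniz_lie e, t.lie_e_f, add_comm]

variable (H : LieSubalgebra F L) [CharZero F] [IsKilling F L] [FiniteDimensional F L]
  [H.IsCartanSubalgebra] [LieModule.IsTriangularizable F H L]

lemma exists_isSl2Triple_of_root (α : H.root) : ∃ e f : L,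
    IsSl2Triple ((coroot α.1 : H) : L) e f ∧ e ∈ rootSpace H ((rootSystem H).root α) ∧
      f ∈ rootSpace H (-((rootSystem H).root α)) := by
  have hα : α.1.IsNonZero := H.isNonZero_coe_root α
  obtain ⟨h, e, f, t, he, hf⟩ := exists_isSl2Triple_of_weight_isNonZero hα
  obtain rfl := t.h_eq_coroot hα he hf
  exact ⟨e, f, t, he, hf⟩

variable {V H}
variable [FiniteDimensional F V]

lemma exists_int_of_isWeight {φ : Module.Dual F H} {v : V} (hv : ∀ h : H, ⁅(h : L), v⁆ = φ h • v)
    (hv0 : v ≠ 0) (α : H.root) : ∃ n : ℤ, φ (coroot α.1) = n := by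
  obtain ⟨e, f, t, -, -⟩ := exists_isSl2Triple_of_root H α
  exact (t.sl2Relations (F := F) V).exists_int_of_apply_eq_smul (hv _) hv0

lemma exists_int_of_mem_weightLattice {φ : Module.Dual F H} (hφ : φ ∈ weightLattice H V)
    (α : H.root) : ∃ n : ℤ, φ (coroot α.1) = n := by
  induction hφ using AddSubgroup.closure_induction with
  | mem φ hφ =>
    obtain ⟨v, hv0, hv⟩ := hφ
    exact exists_int_of_isWeight hv hv0 α
  | zero => exact ⟨0, by simp⟩
  | add φ ψ _ _ h1 h2 =>
    obtain ⟨n, hn⟩ := h1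
    obtain ⟨k, hk⟩ := h2
    exact ⟨n + k, by simp [hn, hk]⟩
  | neg φ _ h1 =>
    obtain ⟨n, hn⟩ := h1
    exact ⟨-n, by simp [hn]⟩

variable (V) in
/-- The pairing of the character lattice with a coroot. -/
noncomputable def corootPairing (α : H.root) : weightLattice H V →+ ℤ where
  toFun φ := (exists_int_of_mem_weightLattice φ.2 α).choose
  map_zero' := by
    apply Int.cast_injective (α := F)
    rw [← (exists_int_of_mem_weightLattice (weightLattice H V).zero_mem α).choose_spec]
    simp
  map_add' φ ψ := by
    apply Int.cast_injective (α := F)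
    rw [Int.cast_add, ← (exists_int_of_mem_weightLattice φ.2 α).choose_spec,
      ← (exists_int_of_mem_weightLattice ψ.2 α).choose_spec,
      ← (exists_int_of_mem_weightLattice (φ + ψ).2 α).choose_spec]
    simp

lemma corootPairing_spec (α : H.root) (φ : weightLattice H V) :
    φ.1 (coroot α.1) = (corootPairing V α φ : F) :=
  (exists_int_of_mem_weightLattice φ.2 α).choose_spec

/-- The weight vectors span a finite-dimensional representation. -/
lemma end_ext_of_weights {A B : Module.End F V}
    (hAB : ∀ (φ : weightLattice H V) (v : V), (∀ h : H, ⁅(h : L), v⁆ = φ.1 h • v) → A v = B v) :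
    A = B := by
  obtain ⟨b⟩ := (rootSystem H).nonempty_base
  let T : b.support → Module.End F V := fun i => LieModule.toEnd F L V (coroot i.1.1 : H)
  have hT (i : b.support) (μ : F) : (T i).maxGenEigenspace μ = (T i).eigenspace μ := by
    obtain ⟨e, f, t, -, -⟩ := exists_isSl2Triple_of_root H i.1
    exact (t.sl2Relations (F := F) V).maxGenEigenspace_eq_eigenspace μ
  have hcomm (i j : b.support) : Commute (T i) (T j) := by
    ext v
    have h0 : ⁅((coroot i.1.1 : H) : L), ((coroot j.1.1 : H) : L)⁆ = 0 := by
      rw [← LieSubalgebra.coe_bracket, trivial_lie_zero, ZeroMemClass.coe_zero]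
    simp only [T, Module.End.mul_apply, LieModule.toEnd_apply_apply]
    rw [leibniz_lie, h0, zero_lie, zero_add]
  have htop := Module.End.iSup_iInf_maxGenEigenspace_eq_top_of_iSup_maxGenEigenspace_eq_top_of_commute
    T (fun i j _ => hcomm i j) fun i => by
      obtain ⟨e, f, t, -, -⟩ := exists_isSl2Triple_of_root H i.1
      rw [eq_top_iff, ← (t.sl2Relations (F := F) V).iSup_eigenspace_eq_top]
      exact iSup_le fun n => le_iSup_of_le (n : F) (hT i n).ge
  rw [← sub_eq_zero, ← LinearMap.ker_eq_top, eq_top_iff, ← htop]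
  refine iSup_le fun χ v hv => ?_
  rw [LinearMap.mem_ker, LinearMap.sub_apply, sub_eq_zero]
  by_cases hv0 : v = 0
  · simp [hv0]
  -- The simple coroots form a basis of `H`, so a joint eigenvector for them is a weight vector,
  -- with `φ` prescribed by the joint eigenvalues.
  let φ : Module.Dual F H := b.toCoweightBasis.constr F χ
  have hφ (h : H) : ⁅(h : L), v⁆ = φ h • v := by
    have : (LieModule.toEnd F L V : L →ₗ[F] Module.End F V).flip v ∘ₗ H.toSubmodule.subtype =
        φ.smulRight v := by
      refine b.toCoweightBasis.ext fun i => ?_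
      have h1 := (Submodule.mem_iInf _).mp hv i
      rw [hT, Module.End.mem_eigenspace_iff] at h1
      rw [LinearMap.smulRight_apply, Basis.constr_basis, b.toCoweightBasis_apply]
      exact h1
    exact LinearMap.congr_fun this h
  exact hAB ⟨φ, AddSubgroup.subset_closure ⟨v, hv0, hφ⟩⟩ v hφ

/-! ### The torus of a Chevalley group -/

/-- The one-parameter subgroup `t ↦ exp (t x)` of the Chevalley group. -/
noncomputable def rootHom {α : Module.Dual F H} (hα : α ≠ 0) {x : L} (hx : x ∈ rootSpace H α)
    (hn : IsNilpotent (LieModule.toEnd F L V x)) : Multiplicative F →* chevalleyGroup H V where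
  toFun t := ⟨⟨nilExp (t.toAdd • LieModule.toEnd F L V x),
      nilExp (-(t.toAdd • LieModule.toEnd F L V x)), nilExp_mul_nilExp_neg (hn.smul _), by
        have := nilExp_mul_nilExp_neg (hn.smul t.toAdd).neg
        rwa [neg_neg] at this⟩,
    Subgroup.subset_closure ⟨α, fun h => hα (DFunLike.coe_injective h), t.toAdd • x,
      Submodule.smul_mem _ _ hx, by rw [map_smul]⟩⟩
  map_one' := by
    ext : 2
    simp
  map_mul' s t := by
    ext : 2
    simp only [toAdd_mul, add_smul, Subgroup.coe_mul, Units.val_mul]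
    exact nilExp_add (((Commute.refl _).smul_left _).smul_right _) (hn.smul _) (hn.smul _)

/-- An `sl₂`-triple attached to a root. -/
structure RootTriple (α : H.root) where
  /-- The raising element. -/
  e : L
  /-- The lowering element. -/
  f : L
  triple : IsSl2Triple ((coroot α.1 : H) : L) e f
  e_mem : e ∈ rootSpace H ((rootSystem H).root α)
  f_mem : f ∈ rootSpace H (-((rootSystem H).root α))

instance (α : H.root) : Nonempty (RootTriple α) := by
  obtain ⟨e, f, t, he, hf⟩ := exists_isSl2Triple_of_root H α
  exact ⟨⟨e, f, t, he, hf⟩⟩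

namespace RootTriple

variable {α β : H.root} (a : RootTriple α)

variable (V) in
omit [FiniteDimensional F V] in
lemma relations : Sl2Relations (LieModule.toEnd F L V (coroot α.1 : H))
    (LieModule.toEnd F L V a.e) (LieModule.toEnd F L V a.f) := a.triple.sl2Relations V

variable (V) in
/-- The root subgroup of `α`. -/
noncomputable def upper : Multiplicative F →* chevalleyGroup H V :=
  rootHom ((rootSystem H).ne_zero α) a.e_mem (a.relations V).isNilpotent_e

variable (V) in
/-- The root subgroup of `-α`. -/
noncomputable def lower : Multiplicative F →* chevalleyGroup H V :=
  rootHom (neg_ne_zero.mpr ((rootSystem H).ne_zero α)) a.f_mem (a.relations V).isNilpotent_f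

variable (V) in
/-- The element `α^∨(t)` of the Chevalley group. -/
noncomputable def cochar (t : Fˣ) : chevalleyGroup H V := torusElement (a.upper V) (a.lower V) t

lemma coe_cochar (t : Fˣ) : ((a.cochar V t : (Module.End F V)ˣ) : Module.End F V) =
    weylEnd (LieModule.toEnd F L V a.e) (LieModule.toEnd F L V a.f) (t : F) *
      weylEnd (LieModule.toEnd F L V a.e) (LieModule.toEnd F L V a.f) (-1) := rfl

lemma cochar_apply (t : Fˣ) (φ : weightLattice H V) {v : V}
    (hv : ∀ h : H, ⁅(h : L), v⁆ = φ.1 h • v) :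
    ((a.cochar V t : (Module.End F V)ˣ) : Module.End F V) v =
      ((t ^ corootPairing V α φ : Fˣ) : F) • v := by
  rw [coe_cochar, (a.relations V).weylEnd_mul_weylEnd_neg_one_apply t.ne_zero
    (n := corootPairing V α φ) (by rw [← corootPairing_spec]; exact hv _),
    Units.val_zpow_eq_zpow_val]

lemma cochar_mul (t u : Fˣ) : a.cochar V (t * u) = a.cochar V t * a.cochar V u := by
  ext : 2
  refine end_ext_of_weights (H := H) fun φ v hv => ?_
  rw [Subgroup.coe_mul, Units.val_mul, Module.End.mul_apply, a.cochar_apply u φ hv, map_smul,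
    a.cochar_apply t φ hv, a.cochar_apply (t * u) φ hv, smul_smul, ← Units.val_mul, mul_zpow,
    mul_comm]

lemma cochar_mul_upper (b : RootTriple β) (t : Fˣ) (s : F) :
    a.cochar V t * b.upper V (.ofAdd s) =
      b.upper V (.ofAdd (((t ^ (rootSystem H).pairingIn ℤ β α : Fˣ) : F) * s)) * a.cochar V t := by
  ext : 2
  have hx : LieModule.toEnd F L V (coroot α.1 : H) * LieModule.toEnd F L V b.e =
      LieModule.toEnd F L V b.e * LieModule.toEnd F L V (coroot α.1 : H) +
        (((rootSystem H).pairingIn ℤ β α : ℤ) : F) • LieModule.toEnd F L V b.e := by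
    have h1 : ⁅((coroot α.1 : H) : L), b.e⁆ = (((rootSystem H).pairingIn ℤ β α : ℤ) : F) • b.e := by
      have := lie_eq_smul_of_mem_rootSpace b.e_mem (coroot α.1)
      rw [← eq_intCast (algebraMap ℤ F), (rootSystem H).algebraMap_pairingIn ℤ]
      exact this
    ext v
    simp only [Module.End.mul_apply, LieModule.toEnd_apply_apply, LinearMap.add_apply,
      LinearMap.smul_apply]
    rw [leibniz_lie, h1, smul_lie, add_comm]
  have := (a.relations V).weylEnd_mul_weylEnd_neg_one_semiconj t.ne_zero hx
  rw [Subgroup.coe_mul, Units.val_mul, Subgroup.coe_mul, Units.val_mul]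
  refine mul_nilExp_of_semiconj ?_
  rw [coe_cochar, mul_smul_comm, toAdd_ofAdd, toAdd_ofAdd, this, mul_comm _ s, mul_smul,
    Units.val_zpow_eq_zpow_val, smul_mul_assoc s]

lemma cochar_mul_lower (b : RootTriple β) (t : Fˣ) (s : F) :
    a.cochar V t * b.lower V (.ofAdd s) =
      b.lower V (.ofAdd (((t ^ (-(rootSystem H).pairingIn ℤ β α) : Fˣ) : F) * s)) *
        a.cochar V t := by
  ext : 2
  have hx : LieModule.toEnd F L V (coroot α.1 : H) * LieModule.toEnd F L V b.f =
      LieModule.toEnd F L V b.f * LieModule.toEnd F L V (coroot α.1 : H) +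
        ((-(rootSystem H).pairingIn ℤ β α : ℤ) : F) • LieModule.toEnd F L V b.f := by
    have h1 : ⁅((coroot α.1 : H) : L), b.f⁆ =
        ((-(rootSystem H).pairingIn ℤ β α : ℤ) : F) • b.f := by
      have := lie_eq_smul_of_mem_rootSpace b.f_mem (coroot α.1)
      rw [Int.cast_neg, ← eq_intCast (algebraMap ℤ F), (rootSystem H).algebraMap_pairingIn ℤ]
      exact this
    ext v
    simp only [Module.End.mul_apply, LieModule.toEnd_apply_apply, LinearMap.add_apply,
      LinearMap.smul_apply]
    rw [leibniz_lie, h1, smul_lie, add_comm]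
  have := (a.relations V).weylEnd_mul_weylEnd_neg_one_semiconj t.ne_zero hx
  rw [Subgroup.coe_mul, Units.val_mul, Subgroup.coe_mul, Units.val_mul]
  refine mul_nilExp_of_semiconj ?_
  rw [coe_cochar, mul_smul_comm, toAdd_ofAdd, toAdd_ofAdd, this, mul_comm _ s, mul_smul,
    Units.val_zpow_eq_zpow_val, smul_mul_assoc s]

end RootTriple

/-- In the simply connected case the torus points with values in `U` are generated by the elements
`α^∨(u)` for long roots `α`. -/
theorem chevalleyTorus_eq_closure (hsc : IsSimplyConnectedRep H V) (a : ∀ α : H.root, RootTriple α)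
    (U : Subgroup Fˣ) : chevalleyTorus H V U = Subgroup.closure
      {g | ∃ α : H.root, IsLongRoot H α ∧ ∃ u ∈ U, g = (a α).cochar V u} := by
  classical
  apply le_antisymm
  · rintro g hg
    obtain ⟨χ, hχ, hgχ⟩ := Subgroup.mem_subgroupOf.mp hg
    set K := Subgroup.closure {g | ∃ α : H.root, IsLongRoot H α ∧ ∃ u ∈ U, g = (a α).cochar V u}
    -- For a cocharacter `y` in the span of the long coroots, `k` is the element `y(u)`, and `N` is
    -- the integral pairing with `y`.
    have key (u : Fˣ) (hu : u ∈ U) (y : H) (hy : y ∈ Submodule.span ℤ {y | ∃ α,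
        IsLongRoot H α ∧ y = (rootSystem H).coroot α}) : ∃ k ∈ K, ∃ N : weightLattice H V →+ ℤ,
          (∀ φ, φ.1 y = (N φ : F)) ∧ ∀ (φ : weightLattice H V) (v : V),
            (∀ h : H, ⁅(h : L), v⁆ = φ.1 h • v) →
              ((k : (Module.End F V)ˣ) : Module.End F V) v = ((u ^ N φ : Fˣ) : F) • v := by
      rw [← Submodule.mem_toAddSubgroup, Submodule.span_int_eq_addSubgroupClosure] at hy
      induction hy using AddSubgroup.closure_induction with
      | mem y hy =>
        obtain ⟨α, hα, rfl⟩ := hy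
        exact ⟨(a α).cochar V u, Subgroup.subset_closure ⟨α, hα, u, hu, rfl⟩, corootPairing V α,
          corootPairing_spec α, fun φ v hv => (a α).cochar_apply u φ hv⟩
      | zero => exact ⟨1, K.one_mem, 0, by simp, by simp⟩
      | add y z _ _ hy hz =>
        obtain ⟨k, hk, N, hN, hkN⟩ := hy
        obtain ⟨k', hk', N', hN', hkN'⟩ := hz
        refine ⟨k * k', K.mul_mem hk hk', N + N', fun φ => ?_, fun φ v hv => ?_⟩
        · rw [map_add, hN, hN', AddMonoidHom.add_apply, Int.cast_add]
        · rw [Subgroup.coe_mul, Units.val_mul, Module.End.mul_apply, hkN' φ v hv, map_smul,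
            hkN φ v hv, smul_smul, AddMonoidHom.add_apply, zpow_add, mul_comm, Units.val_mul]
      | neg y _ hy =>
        obtain ⟨k, hk, N, hN, hkN⟩ := hy
        refine ⟨k⁻¹, K.inv_mem hk, -N, fun φ => ?_, fun φ v hv => ?_⟩
        · rw [map_neg, hN, AddMonoidHom.neg_apply, Int.cast_neg]
        · have h1 := congrArg (((k⁻¹ : chevalleyGroup H V) : (Module.End F V)ˣ) : Module.End F V)
            (hkN φ v hv)
          rw [← Module.End.mul_apply, Subgroup.coe_inv, Units.inv_mul, Module.End.one_apply,
            map_smul] at h1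
          rw [Subgroup.coe_inv, h1, smul_smul, ← Units.val_mul, AddMonoidHom.neg_apply, zpow_neg,
            inv_mul_cancel, Units.val_one, one_smul, ← h1]
    obtain ⟨b⟩ := (rootSystem H).nonempty_base
    -- The coordinates dual to the simple coroots are the fundamental weights; simple connectedness
    -- is exactly what places them in the character lattice.
    have hω (i : b.support) : b.toCoweightBasis.coord i ∈ weightLattice H V := by
      refine hsc _ fun α => ?_
      have hy := b.coroot_mem_span_int α
      generalize (rootSystem H).coroot α = y at hy ⊢
      rw [← Submodule.mem_toAddSubgroup, Submodule.span_int_eq_addSubgroupClosure] at hy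
      induction hy using AddSubgroup.closure_induction with
      | mem y hy =>
        obtain ⟨j, hj, rfl⟩ := hy
        refine ⟨Finsupp.single (⟨j, hj⟩ : b.support) 1 i, ?_⟩
        rw [Basis.coord_apply, b.toCoweightBasis_repr_coroot ⟨j, hj⟩]
        simp [Finsupp.single_apply]
      | zero => exact ⟨0, by simp⟩
      | add y z _ _ hy hz =>
        obtain ⟨n, hn⟩ := hy
        obtain ⟨n', hn'⟩ := hz
        exact ⟨n + n', by rw [map_add, hn, hn', Int.cast_add]⟩
      | neg y _ hy =>
        obtain ⟨n, hn⟩ := hy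
        exact ⟨-n, by rw [map_neg, hn, Int.cast_neg]⟩
    let ω (i : b.support) : weightLattice H V := ⟨_, hω i⟩
    choose k hk N hN hkN using fun i : b.support =>
      key (χ (.ofAdd (ω i))) (hχ _) _ ((rootSystem H).coroot_mem_span_coroot_long i.1)
    have hprod (s : Finset b.support) : ∃ k ∈ K, ∀ (φ : weightLattice H V) (v : V),
        (∀ h : H, ⁅(h : L), v⁆ = φ.1 h • v) → ((k : (Module.End F V)ˣ) : Module.End F V) v =
          ((∏ i ∈ s, χ (.ofAdd (ω i)) ^ N i φ : Fˣ) : F) • v := by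
      induction s using Finset.induction_on with
      | empty => exact ⟨1, K.one_mem, by simp⟩
      | insert i s hi ih =>
        obtain ⟨k', hk', hkN'⟩ := ih
        refine ⟨k' * k i, K.mul_mem hk' (hk i), fun φ v hv => ?_⟩
        rw [Subgroup.coe_mul, Units.val_mul, Module.End.mul_apply, hkN i φ v hv, map_smul,
          hkN' φ v hv, smul_smul, Finset.prod_insert hi, Units.val_mul]
    obtain ⟨k', hk', hkN'⟩ := hprod Finset.univ
    suffices g = k' by rwa [this]
    ext : 2
    refine end_ext_of_weights (H := H) fun φ v hv => ?_
    rw [hkN' φ v hv]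
    refine (hgχ φ v hv).trans ?_
    congr 2
    -- A character is determined by its values on the fundamental weights, so `g` is the product of
    -- the `α_i^∨(χ(ω_i))` over the simple roots.
    have hφ : φ = ∑ i, N i φ • ω i := by
      ext1
      refine b.toCoweightBasis.ext fun j => ?_
      rw [b.toCoweightBasis_apply, hN]
      simp only [AddSubgroup.val_finsetSum, AddSubgroup.coe_zsmul, LinearMap.sum_apply,
        LinearMap.smul_apply, ω, Basis.coord_apply, b.toCoweightBasis_repr_coroot]
      simp [Finsupp.single_apply]
    conv_lhs => rw [hφ]
    rw [ofAdd_sum, map_prod]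
    simp only [ofAdd_zsmul, map_zpow]
  · rw [Subgroup.closure_le]
    rintro _ ⟨α, -, u, hu, rfl⟩
    refine Subgroup.mem_subgroupOf.mpr
      ⟨(zpowersHom Fˣ u).comp (AddMonoidHom.toMultiplicative (corootPairing V α)), ?_⟩
    refine ⟨fun φ => ?_, fun φ v hv => ?_⟩
    · simpa using U.zpow_mem hu _
    · rw [(a α).cochar_apply u φ hv]; rfl

end Weights

/-! ### Kummer theory for the maximal abelian extension -/

section Kummer

variable {F : Type*} [Field F]

lemma IsPrimitiveRoot.exists_apply_eq_pow_smul {A : Type*} [Field A] [Algebra F A] {m : ℕ}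
    [NeZero m] {ζ : F} (hζ : IsPrimitiveRoot ζ m) {b : F} (hb : b ≠ 0) {β : A}
    (hβ : β ^ m = algebraMap F A b) (σ : A →ₐ[F] A) : ∃ i : ℕ, σ β = ζ ^ i • β := by
  have hβ0 : β ≠ 0 := by
    rintro rfl
    rw [zero_pow (NeZero.ne m), eq_comm, map_eq_zero] at hβ
    exact hb hβ
  have h : (σ β / β) ^ m = 1 := by
    rw [div_pow, ← map_pow, hβ, σ.commutes, div_self]
    rwa [ne_eq, map_eq_zero]
  obtain ⟨i, -, hi⟩ := (hζ.map_of_injective (algebraMap F A).injective).eq_pow_of_pow_eq_one h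
  exact ⟨i, by rw [Algebra.smul_def, map_pow, hi, div_mul_cancel₀ _ hβ0]⟩

/-- Every element has an `m`-th root in the maximal abelian extension of a field that contains
the `m`-th roots of unity. -/
theorem exists_pow_eq_algebraMap_maxAbelianExtension [CharZero F] {m : ℕ} [NeZero m] {ζ : F}
    (hζ : IsPrimitiveRoot ζ m) {b : F} (hb : b ≠ 0) :
    ∃ β : maxAbelianExtension F, β ^ m = algebraMap F (maxAbelianExtension F) b := by
  obtain ⟨β, hβ⟩ := IsAlgClosed.exists_pow_nat_eq (algebraMap F (AlgebraicClosure F) b)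
    (Nat.pos_of_ne_zero (NeZero.ne m))
  have hint : IsIntegral F β := Algebra.IsIntegral.isIntegral β
  let K := IntermediateField.adjoin F {β}
  have hmem : β ∈ K := IntermediateField.mem_adjoin_simple_self F β
  have hfin : FiniteDimensional F K := IntermediateField.adjoin.finiteDimensional hint
  have hnormal : Normal F K := by
    rw [IntermediateField.normal_iff_forall_map_le]
    intro σ
    rw [IntermediateField.adjoin_map, IntermediateField.adjoin_le_iff, Set.image_singleton,
      Set.singleton_subset_iff]
    obtain ⟨i, hi⟩ := hζ.exists_apply_eq_pow_smul hb hβ σ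
    rw [hi]
    exact K.smul_mem hmem
  have hgal : IsGalois F K := ⟨⟩
  -- Each automorphism multiplies the generator `β` by a scalar of `F`, and such scalings commute.
  have hcomm : IsMulCommutative Gal(K/F) := by
    refine .of_comm fun σ τ => ?_
    have hsmul (ρ : Gal(K/F)) (a : F) (y : K) : ρ (a • y) = a • ρ y := by
      rw [Algebra.smul_def, map_mul, ρ.commutes, Algebra.smul_def]
    have hβ' : (⟨β, hmem⟩ : K) ^ m = algebraMap F K b := Subtype.ext hβ
    obtain ⟨i, hi⟩ := hζ.exists_apply_eq_pow_smul hb hβ' σ.toAlgHom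
    obtain ⟨j, hj⟩ := hζ.exists_apply_eq_pow_smul hb hβ' τ.toAlgHom
    replace hi : σ ⟨β, hmem⟩ = ζ ^ i • ⟨β, hmem⟩ := hi
    replace hj : τ ⟨β, hmem⟩ = ζ ^ j • ⟨β, hmem⟩ := hj
    have h : ((σ * τ : Gal(K/F)) : K →ₐ[F] K) = ((τ * σ : Gal(K/F)) : K →ₐ[F] K) := by
      refine IntermediateField.algHom_ext_of_eq_adjoin (S := K) F rfl fun x hx => ?_
      obtain rfl : x = β := hx
      change σ (τ ⟨x, hmem⟩) = τ (σ ⟨x, hmem⟩)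
      rw [hi, hj, hsmul, hsmul, hi, hj, smul_comm]
    exact AlgEquiv.ext fun x => congrArg (fun g : K →ₐ[F] K => g x) h
  have hab : IsAbelianGalois F K := ⟨⟩
  have hle : K ≤ maxAbelianExtension F :=
    le_iSup (fun L : {L : IntermediateField F (AlgebraicClosure F) //
      FiniteDimensional F L ∧ IsAbelianGalois F L} => L.1) ⟨K, hfin, hab⟩
  exact ⟨⟨β, hle hmem⟩, Subtype.ext hβ⟩

end Kummer

/-! ### Units of Henselian discrete valuation rings -/

section Henselian

open IsLocalRing Polynomial

variable {O : Type*} [CommRing O] [IsLocalRing O]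

/-- As `m` is a unit, `X ^ l ^ m`-type collisions cannot occur: the roots of `X ^ m - 1` are simple
modulo the maximal ideal, so distinct roots of unity stay distinct in the residue field. -/
lemma IsLocalRing.isPrimitiveRoot_residue [IsDomain O] {m : ℕ} (hm : IsUnit (m : O)) {ζ : O}
    (hζ : IsPrimitiveRoot ζ m) :
    IsPrimitiveRoot (residue O ζ) m := by
  refine ⟨by rw [← map_pow, hζ.pow_eq_one, map_one], fun l hl => hζ.dvd_of_pow_eq_one l ?_⟩
  refine eq_of_eval_eq_zero_of_not_isUnit_sub (f := X ^ m - C 1) ?_ ?_ ?_ ?_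
  · simp [← pow_mul, mul_comm l, pow_mul ζ, hζ.pow_eq_one]
  · simp
  · rw [← mem_nonunits_iff, ← mem_maximalIdeal, ← residue_eq_zero_iff, map_sub, map_pow, hl,
      map_one, sub_self]
  · have h0 : m ≠ 0 := by rintro rfl; simp at hm
    simpa [derivative_X_pow] using hm.mul (((hζ.isUnit h0).pow l).pow (m - 1))

section Finite

variable [Finite (ResidueField O)]

lemma IsLocalRing.isUnit_natCard_residueField_sub_one :
    IsUnit ((Nat.card (ResidueField O) - 1 : ℕ) : O) := by
  have := Fintype.ofFinite (ResidueField O)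
  rw [← residue_ne_zero_iff_isUnit, map_natCast, Nat.cast_sub Nat.card_pos,
    Nat.card_eq_fintype_card, FiniteField.cast_card_eq_zero]
  simp

lemma IsLocalRing.coprime_natCard_residueField {m : ℕ} (hm : IsUnit (m : O)) :
    m.Coprime (Nat.card (ResidueField O)) := by
  have := Fintype.ofFinite (ResidueField O)
  rw [← residue_ne_zero_iff_isUnit, map_natCast] at hm
  obtain ⟨n, hp, hn⟩ := FiniteField.card (ResidueField O) (ringChar (ResidueField O))
  rw [Nat.card_eq_fintype_card, hn]
  refine Nat.Coprime.pow_right _ (Nat.Coprime.symm (hp.coprime_iff_not_dvd.2 fun h => hm ?_))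
  rwa [← ringChar.spec] at h

lemma IsLocalRing.natCard_residueField_sub_one_ne_zero : Nat.card (ResidueField O) - 1 ≠ 0 :=
  Nat.sub_ne_zero_of_lt Finite.one_lt_card

end Finite

variable [HenselianRing O (maximalIdeal O)]

lemma HenselianRing.exists_pow_eq {n : ℕ} (hn : IsUnit (n : O)) (hn0 : n ≠ 0) {u w : O}
    (hw : IsUnit w) (h : w ^ n - u ∈ maximalIdeal O) :
    ∃ x : O, x ^ n = u ∧ x - w ∈ maximalIdeal O := by
  obtain ⟨x, hx, hxw⟩ := HenselianRing.is_henselian (I := maximalIdeal O) (X ^ n - C u)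
    (monic_X_pow_sub_C u hn0) w (by simpa using h)
    (by simpa [derivative_X_pow] using
      (hn.mul (hw.pow (n - 1))).map (Ideal.Quotient.mk (maximalIdeal O)))
  exact ⟨x, by simpa [IsRoot.def, sub_eq_zero] using hx, hxw⟩

variable [Finite (ResidueField O)]

/-- The Teichmüller representative: `u` is an approximate root of `X ^ (q - 1) - 1`, with `q` the
order of the residue field. -/
lemma HenselianRing.exists_pow_eq_one {u : O} (hu : IsUnit u) :
    ∃ ζ : O, ζ ^ (Nat.card (ResidueField O) - 1) = 1 ∧ residue O ζ = residue O u := by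
  have := Fintype.ofFinite (ResidueField O)
  obtain ⟨ζ, hζ, h⟩ := exists_pow_eq (u := 1) isUnit_natCard_residueField_sub_one
    natCard_residueField_sub_one_ne_zero hu (by
      rw [← residue_eq_zero_iff, map_sub, map_pow, map_one, Nat.card_eq_fintype_card,
        FiniteField.pow_card_sub_one_eq_one _ ((residue_ne_zero_iff_isUnit u).2 hu), sub_self])
  exact ⟨ζ, hζ, by rwa [← residue_eq_zero_iff, map_sub, sub_eq_zero] at h⟩

/-- After division by its Teichmüller representative, `u` is congruent to `1`, and Hensel's lemma
extracts an `m`-th root. -/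
lemma HenselianRing.exists_eq_mul_pow {m : ℕ} (hm : IsUnit (m : O)) (hm0 : m ≠ 0) (u : Oˣ) :
    ∃ ζ w : Oˣ, ζ ^ (Nat.card (ResidueField O) - 1) = 1 ∧ u = ζ * w ^ m := by
  obtain ⟨ζ, hζ, h⟩ := exists_pow_eq_one u.isUnit
  let z : Oˣ := Units.ofPowEqOne ζ _ hζ natCard_residueField_sub_one_ne_zero
  obtain ⟨x, hx, -⟩ := exists_pow_eq (u := ((z⁻¹ * u : Oˣ) : O)) hm hm0 isUnit_one (by
    rw [← residue_eq_zero_iff, one_pow, map_sub, map_one, sub_eq_zero, Units.val_mul, map_mul, ← h]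
    change _ = _ * residue O (z : O)
    rw [← map_mul, Units.inv_mul, map_one])
  have hxu : IsUnit x := (isUnit_pow_iff hm0).1 (hx ▸ Units.isUnit _)
  refine ⟨z, hxu.unit, Units.pow_ofPowEqOne _ _, Units.ext ?_⟩
  rw [Units.val_mul, Units.val_pow_eq_pow_val, IsUnit.unit_spec, hx, ← Units.val_mul,
    mul_inv_cancel_left]

lemma HenselianRing.exists_orderOf_eq :
    ∃ ζ : Oˣ, orderOf ζ = Nat.card (ResidueField O) - 1 := by
  have := Fintype.ofFinite (ResidueField O)
  obtain ⟨g, hg⟩ := IsCyclic.exists_ofOrder_eq_natCard (α := (ResidueField O)ˣ)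
  obtain ⟨u, hu⟩ := residue_surjective (g : ResidueField O)
  obtain ⟨ζ, hζ, h⟩ := exists_pow_eq_one (u := u)
    ((residue_ne_zero_iff_isUnit u).1 (hu ▸ g.ne_zero))
  let z : Oˣ := Units.ofPowEqOne ζ _ hζ natCard_residueField_sub_one_ne_zero
  refine ⟨z, Nat.dvd_antisymm (orderOf_dvd_of_pow_eq_one (Units.pow_ofPowEqOne _ _)) ?_⟩
  rw [← Nat.card_units, ← hg]
  have : Units.map (residue O : O →* ResidueField O) z = g := Units.ext (h.trans hu)
  rw [← this]
  exact orderOf_map_dvd _ z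

end Henselian

/-! ### Values of the Hilbert symbol -/

section HilbertSymbolValues

open IsLocalRing

variable {F : Type*} [Field F] {O : ValuationSubring F}

lemma ValuationSubring.mem_of_pow_eq_one {m : ℕ} (hm : m ≠ 0) {x : F} (h : x ^ m = 1) : x ∈ O := by
  rcases O.mem_or_inv_mem x with hx | hx
  · exact hx
  · have : x = x⁻¹ ^ (m - 1) := by
      have hx0 : x ≠ 0 := by rintro rfl; simp [hm] at h
      rw [inv_pow]
      exact eq_inv_of_mul_eq_one_right (by rw [← pow_succ, Nat.sub_one_add_one hm, h])
    rw [this]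
    exact pow_mem hx _

lemma ValuationSubring.exists_eq_zpow_mul [IsDiscreteValuationRing O] {p : O} (hp : Irreducible p)
    {ϖ : Fˣ} (hϖ : (ϖ : F) = p) (t : Fˣ) :
    ∃ k : ℤ, ∃ u ∈ O.unitGroup, t = ϖ ^ k * u := by
  have key (x : O) (hx : (x : F) ≠ 0) :
      ∃ k : ℕ, ∃ u : Oˣ, (x : F) = (ϖ : F) ^ k * ((u : O) : F) := by
    obtain ⟨n, u, hu⟩ := IsDiscreteValuationRing.eq_unit_mul_pow_irreducible
      (x := x) (fun h => hx (by rw [h]; rfl)) hp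
    exact ⟨n, u, by rw [hu, hϖ, mul_comm]; rfl⟩
  rcases O.mem_or_inv_mem t with h | h
  · obtain ⟨k, u, hk⟩ := key ⟨t, h⟩ t.ne_zero
    refine ⟨k, (O.unitGroupMulEquiv.symm u : Fˣ), Subtype.property _, Units.ext ?_⟩
    simpa using hk
  · obtain ⟨k, u, hk⟩ := key ⟨_, h⟩ (inv_ne_zero t.ne_zero)
    refine ⟨-k, ((O.unitGroupMulEquiv.symm u)⁻¹ : O.unitGroup), Subtype.property _, ?_⟩
    rw [InvMemClass.coe_inv, zpow_neg, ← mul_inv, ← inv_eq_iff_eq_inv]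
    refine Units.ext ?_
    simpa using hk

lemma ValuationSubring.exists_eq_mul_pow [Finite (ResidueField O)]
    [HenselianRing O (maximalIdeal O)] {m : ℕ} [NeZero m] (hm : IsUnit (m : O)) {u : Fˣ}
    (hu : u ∈ O.unitGroup) :
    ∃ ζ ∈ O.unitGroup, ∃ w : Fˣ, ζ ^ (Nat.card (ResidueField O) - 1) = 1 ∧ u = ζ * w ^ m := by
  obtain ⟨ζ, w, hζ, h⟩ :=
    HenselianRing.exists_eq_mul_pow hm (NeZero.ne m) (O.unitGroupMulEquiv ⟨u, hu⟩)
  rw [← MulEquiv.eq_symm_apply, map_mul, map_pow] at h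
  refine ⟨_, (O.unitGroupMulEquiv.symm ζ).2, (O.unitGroupMulEquiv.symm w : Fˣ), ?_, ?_⟩
  · rw [← SubgroupClass.coe_pow, ← map_pow, hζ, map_one, OneMemClass.coe_one]
  · exact congrArg Subtype.val h

namespace IsHilbertSymbol

variable {m : ℕ} [NeZero m] {ξ : F} {c : Fˣ → Fˣ → rootsOfUnity m F}

lemma zpow_right [CharZero F] (hc : IsHilbertSymbol O m c) (hξ : IsPrimitiveRoot ξ m)
    (a b : Fˣ) (n : ℤ) :
    c a (b ^ n) = c a b ^ n := by
  obtain ⟨θ, -, hθ⟩ := hc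
  obtain ⟨β, hβ⟩ := exists_pow_eq_algebraMap_maxAbelianExtension hξ b.ne_zero
  have hβ0 : β ≠ 0 := by
    rintro rfl
    rw [zero_pow (NeZero.ne m), eq_comm, map_eq_zero] at hβ
    exact b.ne_zero hβ
  have hβn : (β ^ n) ^ m = algebraMap F (maxAbelianExtension F) ((b ^ n : Fˣ) : F) := by
    rw [← zpow_natCast, zpow_comm, zpow_natCast, hβ, ← map_zpow₀, Units.val_zpow_eq_zpow_val]
  have h := hθ a _ _ hβn
  rw [map_zpow₀, hθ a b β hβ, Algebra.smul_def, Algebra.smul_def, mul_zpow,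
    mul_left_inj' (zpow_ne_zero n hβ0), ← map_zpow₀] at h
  refine Subtype.ext (Units.ext ?_)
  rw [SubgroupClass.coe_zpow, Units.val_zpow_eq_zpow_val]
  exact ((algebraMap F (maxAbelianExtension F)).injective h).symm

/-- If `p` is a uniformizer then so is `u * p`. Both act on `ζ` by the same Frobenius, so `u` acts
trivially. -/
lemma apply_eq_of_pow_eq_one [IsDiscreteValuationRing O]
    {θ : Fˣ →* (maxAbelianExtension F ≃ₐ[F] maxAbelianExtension F)}
    (hθ : IsLocalArtinMap O θ) {n : ℕ} (hn : n.Coprime (Nat.card (ResidueField O)))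
    {ζ : maxAbelianExtension F} (hζ : ζ ^ n = 1) {u : Fˣ} (hu : u ∈ O.unitGroup) : θ u ζ = ζ := by
  obtain ⟨p, hp⟩ := IsDiscreteValuationRing.exists_irreducible O
  let ϖ : Fˣ := Units.mk0 p fun h => hp.ne_zero (Subtype.ext h)
  let u' : Oˣ := O.unitGroupMulEquiv ⟨u, hu⟩
  have h1 := hθ.frobenius p ϖ hp rfl n ζ hn hζ
  have h2 := hθ.frobenius (u' * p) (u * ϖ) ((irreducible_units_mul u').2 hp) rfl n ζ hn hζ
  rw [mul_comm, map_mul, AlgEquiv.mul_apply, ← h1] at h2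
  exact (θ ϖ).injective h2

variable [Finite (ResidueField O)] [HenselianRing O (maximalIdeal O)] [CharZero F]

/-- The tame symbol of two units is trivial. -/
theorem apply_units [IsDiscreteValuationRing O] (hc : IsHilbertSymbol O m c)
    (hξ : IsPrimitiveRoot ξ m) (hm : IsUnit (m : O))
    {u v : Fˣ} (hu : u ∈ O.unitGroup) (hv : v ∈ O.unitGroup) : c u v = 1 := by
  obtain ⟨θ, hθ, h⟩ := hc
  obtain ⟨ζ, -, w, hζ, rfl⟩ := ValuationSubring.exists_eq_mul_pow hm hv
  obtain ⟨β, hβ⟩ := exists_pow_eq_algebraMap_maxAbelianExtension hξ ζ.ne_zero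
  have hβ0 : β ≠ 0 := by
    rintro rfl
    rw [zero_pow (NeZero.ne m), eq_comm, map_eq_zero] at hβ
    exact ζ.ne_zero hβ
  have hβ1 : β ^ (m * (Nat.card (ResidueField O) - 1)) = 1 := by
    rw [pow_mul, hβ, ← map_pow, ← Units.val_pow_eq_pow_val, hζ, Units.val_one, map_one]
  have hco := (coprime_natCard_residueField hm).mul_left
    (coprime_natCard_residueField (O := O) isUnit_natCard_residueField_sub_one)
  have hθβ := apply_eq_of_pow_eq_one hθ hco hβ1 hu
  have key := h u (ζ * w ^ m) (β * algebraMap F _ (w : F)) (by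
    rw [mul_pow, hβ, ← map_pow, ← map_mul, Units.val_mul, Units.val_pow_eq_pow_val])
  rw [map_mul, hθβ, AlgEquiv.commutes, Algebra.smul_def, eq_comm,
    mul_eq_right₀ (mul_ne_zero hβ0 (by simp)), map_eq_one_iff _ (algebraMap F _).injective] at key
  exact Subtype.ext (Units.ext key)

/-- The tame symbol `(ϖ, ζ)` of a uniformizer and a generator `ζ` of the group of roots of unity
of order prime to the residue characteristic has order `m`. -/
theorem exists_dvd_of_zpow_eq_one (hc : IsHilbertSymbol O m c) (hξ : IsPrimitiveRoot ξ m)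
    (hm : IsUnit (m : O)) {p : O} (hp : Irreducible p) {ϖ : Fˣ} (hϖ : (ϖ : F) = p) :
    ∃ ζ ∈ O.unitGroup, ∀ k : ℤ, c ϖ ζ ^ k = 1 → (m : ℤ) ∣ k := by
  obtain ⟨θ, hθ, h⟩ := hc
  obtain ⟨z, hz⟩ := HenselianRing.exists_orderOf_eq (O := O)
  set q := Nat.card (ResidueField O) with hq
  let ζ : Fˣ := (O.unitGroupMulEquiv.symm z : Fˣ)
  have hζ : orderOf ζ = q - 1 := by
    rw [← hz, Subgroup.orderOf_coe, MulEquiv.orderOf_eq]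
  obtain ⟨β, hβ⟩ := exists_pow_eq_algebraMap_maxAbelianExtension hξ ζ.ne_zero
  have hβ0 : β ≠ 0 := by
    rintro rfl
    rw [zero_pow (NeZero.ne m), eq_comm, map_eq_zero] at hβ
    exact ζ.ne_zero hβ
  have hq0 : q - 1 ≠ 0 := natCard_residueField_sub_one_ne_zero (O := O)
  have hβm : orderOf (β ^ m) = q - 1 := by
    rw [hβ, ← hζ, ← orderOf_units]
    exact orderOf_injective (algebraMap F (maxAbelianExtension F) : F →* maxAbelianExtension F)
      (algebraMap F (maxAbelianExtension F)).injective _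
  have hβ1 : β ^ (m * (q - 1)) = 1 := by
    rw [pow_mul, ← hβm, pow_orderOf_eq_one]
  have hco := (coprime_natCard_residueField hm).mul_left
    (coprime_natCard_residueField (O := O) isUnit_natCard_residueField_sub_one)
  have hmq : m ∣ q - 1 := by
    have := Fintype.ofFinite (ResidueField O)
    have hξO : IsPrimitiveRoot
        (⟨ξ, ValuationSubring.mem_of_pow_eq_one (NeZero.ne m) hξ.pow_eq_one⟩ : O) m :=
      hξ.of_map_of_injective (f := O.subtype) Subtype.val_injective
    have hr := isPrimitiveRoot_residue hm hξO
    refine hr.dvd_of_pow_eq_one _ ?_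
    rw [hq, Nat.card_eq_fintype_card]
    exact FiniteField.pow_card_sub_one_eq_one _ (hr.ne_zero (NeZero.ne m))
  -- Since `m ∣ q - 1` and `q - 1` is the order of `β ^ m`, `m` divides the order of `β`, so raising
  -- to the `m`-th power divides that order by exactly `m`. Frobenius then gives the symbol as `β ^
  -- (q - 1)`, of order `m`.
  have hord : orderOf β = m * (q - 1) := by
    refine Nat.dvd_antisymm (orderOf_dvd_of_pow_eq_one hβ1) ?_
    have h1 : m ∣ orderOf β := by
      refine hmq.trans ?_
      rw [← hβm]
      exact orderOf_pow_dvd m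
    rw [orderOf_pow_of_dvd (NeZero.ne m) h1] at hβm
    rw [← hβm, Nat.mul_div_cancel' h1]
  refine ⟨ζ, (O.unitGroupMulEquiv.symm z).2, fun k hk => ?_⟩
  have key := h ϖ ζ β hβ
  rw [hθ.frobenius p ϖ hp hϖ _ β hco hβ1, ← hq, ← Nat.sub_one_add_one (a := q) (by omega),
    pow_succ, Algebra.smul_def, mul_left_inj' hβ0] at key
  have hk' : (β ^ (q - 1)) ^ k = 1 := by
    rw [key, ← map_zpow₀, ← Units.val_zpow_eq_zpow_val, ← SubgroupClass.coe_zpow, hk]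
    simp
  have h2 : ((Units.mk0 β hβ0) ^ (((q - 1 : ℕ) : ℤ) * k)) = 1 := by
    refine Units.ext ?_
    rw [Units.val_zpow_eq_zpow_val, zpow_mul, zpow_natCast]
    exact hk'
  rw [← orderOf_dvd_iff_zpow_eq_one, ← orderOf_units, Units.val_mk0, hord, Nat.cast_mul,
    mul_comm] at h2
  exact Int.dvd_of_mul_dvd_mul_left (by exact_mod_cast hq0) h2

end IsHilbertSymbol

end HilbertSymbolValues

/-! ### Completions of number fields -/

section AdicCompletion

open IsLocalRing IsDedekindDomain HeightOneSpectrum WithZero MonoidWithZeroHom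

variable {k : Type*} [Field k] [NumberField k] (v : HeightOneSpectrum (𝓞 k))

lemma IsDedekindDomain.HeightOneSpectrum.mem_maximalIdeal_adicCompletionIntegers_iff
    {x : v.adicCompletionIntegers k} :
    x ∈ maximalIdeal (v.adicCompletionIntegers k) ↔ Valued.v (x : v.adicCompletion k) < 1 := by
  rw [mem_maximalIdeal, mem_nonunits_iff, adicCompletionIntegers.isUnit_iff_valued_eq_one]
  exact ⟨fun h => lt_of_le_of_ne x.2 h, ne_of_lt⟩

/-- Density of `k` approximates an integral element by some `y` in `k` that is integral at `v`, and
`y` is in turn approximated by a global integer. This bounds the residue field by a quotient of `𝓞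
k`. -/
theorem IsDedekindDomain.HeightOneSpectrum.residue_algebraMap_surjective :
    Function.Surjective ((residue (v.adicCompletionIntegers k)).comp
      (algebraMap (𝓞 k) (v.adicCompletionIntegers k))) := by
  intro x
  obtain ⟨x, rfl⟩ := residue_surjective x
  have hopen : IsOpen {y : v.adicCompletion k | Valued.v (y - x) < 1} := by
    have h := Valued.isOpen_ball (v.adicCompletion k) 1
    simp only [Valuation.restrict_lt_one_iff] at h
    exact h.preimage (f := fun y => y - (x : v.adicCompletion k)) (by fun_prop)
  obtain ⟨y, hy⟩ := (denseRange_algebraMap k v).exists_mem_open hopen ⟨x, by simp⟩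
  have hy1 : v.valuation k y ≤ 1 := by
    rw [← valuedAdicCompletion_eq_valuation']
    have h := (Valued.v : Valuation (v.adicCompletion k) ℤᵐ⁰).map_add
      (algebraMap k (v.adicCompletion k) y - x) x
    rw [sub_add_cancel] at h
    exact h.trans (max_le (le_of_lt hy) x.2)
  obtain ⟨a, ha⟩ := exists_valuation_sub_lt_of_integer v hy1 1
  refine ⟨a, ?_⟩
  rw [RingHom.comp_apply, ← sub_eq_zero, ← map_sub, residue_eq_zero_iff,
    mem_maximalIdeal_adicCompletionIntegers_iff]
  rw [← valuedAdicCompletion_eq_valuation'] at ha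
  change Valued.v (algebraMap k (v.adicCompletion k) (algebraMap (𝓞 k) k a - y)) < 1 at ha
  rw [map_sub] at ha
  have h := (Valued.v : Valuation (v.adicCompletion k) ℤᵐ⁰).map_add_lt ha hy
  rw [sub_add_sub_cancel] at h
  exact h

instance : Finite (ResidueField (v.adicCompletionIntegers k)) := by
  have : Finite (𝓞 k ⧸ v.asIdeal) := v.asIdeal.finiteQuotientOfFreeOfNeBot v.ne_bot
  refine Finite.of_surjective (Ideal.Quotient.lift v.asIdeal _ fun a ha => ?_)
    (Ideal.Quotient.lift_surjective_of_surjective _ _ (residue_algebraMap_surjective v))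
  rw [RingHom.comp_apply, residue_eq_zero_iff, mem_maximalIdeal_adicCompletionIntegers_iff]
  rw [← valuation_lt_one_iff_mem (K := k), ← valuedAdicCompletion_eq_valuation'] at ha
  exact ha

lemma IsDedekindDomain.HeightOneSpectrum.isUnit_natCast_adicCompletionIntegers {m : ℕ}
    (hm : (m : 𝓞 k) ∉ v.asIdeal) : IsUnit (m : v.adicCompletionIntegers k) := by
  rw [adicCompletionIntegers.isUnit_iff_valued_eq_one]
  rw [← valuation_eq_one_iff_notMem (K := k), ← valuedAdicCompletion_eq_valuation] at hm
  simpa using hm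

/-- Powers of the maximal ideal are closed balls for the valuation, so adic Cauchy sequences
converge in the complete field, and the congruences pass to the limit. This supplies Hensel's lemma.
-/
instance : IsAdicComplete (maximalIdeal (v.adicCompletionIntegers k))
    (v.adicCompletionIntegers k) where
  haus' x hx := by
    have h := Ideal.iInf_pow_eq_bot_of_isLocalRing (maximalIdeal (v.adicCompletionIntegers k))
      (IsLocalRing.maximalIdeal.isMaximal _).ne_top
    rw [← Ideal.mem_bot, ← h, Ideal.mem_iInf]
    intro n
    have := hx n
    rwa [SModEq.zero, smul_eq_mul, Ideal.mul_top] at this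
  prec' f hf := by
    obtain ⟨p, hp⟩ := IsDiscreteValuationRing.exists_irreducible (v.adicCompletionIntegers k)
    have hmem (n : ℕ) (x : v.adicCompletionIntegers k) :
        x ∈ maximalIdeal (v.adicCompletionIntegers k) ^ n ↔
          Valued.v.restrict (x : v.adicCompletion k) ≤
            Valued.v.restrict ((p : v.adicCompletion k) ^ n) := by
      rw [hp.maximalIdeal_eq, Ideal.span_singleton_pow, Ideal.mem_span_singleton,
        ← (adicCompletionIntegers.integers k v).le_iff_dvd, Valuation.restrict_le_iff]
      rfl
    have hp1 : Valued.v (p : v.adicCompletion k) < 1 :=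
      (mem_maximalIdeal_adicCompletionIntegers_iff v).1 hp.not_isUnit
    simp only [smul_eq_mul, Ideal.mul_top, SModEq.sub_mem, hmem] at hf ⊢
    have hcauchy : CauchySeq fun n => (f n : v.adicCompletion k) := by
      rw [(Valued.hasBasis_uniformity (v.adicCompletion k) ℤᵐ⁰).cauchySeq_iff']
      intro γ _
      obtain ⟨N, hN⟩ : ∃ N : ℕ, Valued.v (p : v.adicCompletion k) ^ N <
        ValueGroup₀.embedding
          (γ : ValueGroup₀ (.ofClass (Valued.v : Valuation (v.adicCompletion k) ℤᵐ⁰))) :=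
        exists_pow_lt₀ hp1 (Units.mk0 _ ((map_ne_zero (ValueGroup₀.embedding (f := .ofClass
          (Valued.v : Valuation (v.adicCompletion k) ℤᵐ⁰)))).2 γ.ne_zero))
      refine ⟨N, fun n hn => ?_⟩
      rw [← map_pow, ← Valuation.restrict_lt_iff_lt_embedding] at hN
      exact (hf hn).trans_lt hN
    obtain ⟨L, hL⟩ := cauchySeq_tendsto_of_complete hcauchy
    have key (n : ℕ) : Valued.v.restrict (f n - L) ≤
        Valued.v.restrict ((p : v.adicCompletion k) ^ n) := by
      refine (Valued.isClosed_closedBall (v.adicCompletion k) (Valued.v.restrict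
        ((p : v.adicCompletion k) ^ n))).mem_of_tendsto
        (Filter.Tendsto.const_sub ((f n : v.adicCompletion k)) hL) ?_
      filter_upwards [Filter.eventually_ge_atTop n] with j hj
      exact hf hj
    have hLmem : L ∈ v.adicCompletionIntegers k := by
      refine (Valued.isClosed_valuationSubring (v.adicCompletion k)).mem_of_tendsto hL ?_
      exact Filter.Eventually.of_forall fun n => (f n).2
    exact ⟨⟨L, hLmem⟩, key⟩

end AdicCompletion

/-! ### Commutators of canonical lifts -/

section TorusElement

variable {F E G : Type*} [Field F] [Group E] [Group G]

lemma weylElement_inv (X Y : Multiplicative F →* E) (t : Fˣ) :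
    (weylElement X Y t)⁻¹ = weylElement X Y (-t) := by
  simp only [weylElement, mul_inv_rev, ← map_inv, ← ofAdd_neg, Units.val_neg, inv_neg, neg_neg,
    mul_assoc]

lemma map_torusElement (π : E →* G) (X Y : Multiplicative F →* E) (t : Fˣ) :
    π (torusElement X Y t) = torusElement (π.comp X) (π.comp Y) t := by
  simp [torusElement, weylElement]

/-- Conjugation by `g` sends `w(t)` to `w(rt)`, so `h(u) = w(u) w(-1)` goes to `w(ru) w(-r)`, and
`w(-r) = w(r)⁻¹`. -/
lemma semiconjBy_torusElement {X Y : Multiplicative F →* E} {g : E} {r : Fˣ}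
    (hX : ∀ s : F, g * X (.ofAdd s) = X (.ofAdd (r * s)) * g)
    (hY : ∀ s : F, g * Y (.ofAdd s) = Y (.ofAdd ((r : F)⁻¹ * s)) * g) (u : Fˣ) :
    SemiconjBy g (torusElement X Y u) (torusElement X Y (r * u) * (torusElement X Y r)⁻¹) := by
  have hw (t : Fˣ) : SemiconjBy g (weylElement X Y t) (weylElement X Y (r * t)) := by
    refine (SemiconjBy.mul_right (hX _) ?_).mul_right (hX _)
    have := hY (-(t : F)⁻¹)
    rwa [mul_neg, ← mul_inv, ← Units.val_mul] at this
  have h := (hw u).mul_right (hw (-1))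
  have e : torusElement X Y (r * u) * (torusElement X Y r)⁻¹ =
      weylElement X Y (r * u) * weylElement X Y (r * -1) := by
    rw [torusElement, torusElement, mul_inv_rev, weylElement_inv X Y r, mul_neg, mul_one]
    group
  rwa [← e] at h

/-- The commutator of a canonical lift `h(u)` with an element that acts on the
root subgroups through the scalar `r` is given by the cocycle. -/
lemma torusElement_mul_eq {X Y : Multiplicative F →* E} {g : E} {r : Fˣ}
    (hX : ∀ s : F, g * X (.ofAdd s) = X (.ofAdd (r * s)) * g)
    (hY : ∀ s : F, g * Y (.ofAdd s) = Y (.ofAdd ((r : F)⁻¹ * s)) * g) (u : Fˣ) {z : E}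
    (hz : torusElement X Y u * torusElement X Y r = z * torusElement X Y (u * r)) :
    torusElement X Y u * g = z * (g * torusElement X Y u) := by
  have h : g * torusElement X Y u = _ := semiconjBy_torusElement hX hY u
  rw [h, mul_comm r u, ← mul_assoc, ← mul_assoc, ← hz, mul_inv_cancel_right]

variable {π : E →* G}

/-- Conjugating `X` by `g` and rescaling its parameter by `r` give two lifts of the same
homomorphism, which agree by uniqueness. A relation in the group thus lifts to the extension. -/
lemma mul_eq_mul_of_divisible [CharZero F] {m : ℕ} (hm : m ≠ 0)
    (hcen : π.ker ≤ Subgroup.center E) (hexp : ∀ z ∈ π.ker, z ^ m = 1) {X : Multiplicative F →* E}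
    {g : E} {r : F} (h : ∀ s : F, π g * π (X (.ofAdd s)) = π (X (.ofAdd (r * s))) * π g) (s : F) :
    g * X (.ofAdd s) = X (.ofAdd (r * s)) * g := by
  have key := lift_unique_of_divisible hm hcen hexp
    (X := (MulAut.conj g).toMonoidHom.comp X)
    (Y := X.comp (AddMonoidHom.toMultiplicative (AddMonoidHom.mulLeft r))) fun s => by
      have hs : π (g * X s * g⁻¹) = π (X (.ofAdd (r * s.toAdd))) := by
        rw [map_mul, map_mul, map_inv, mul_inv_eq_iff_eq_mul]
        exact h s.toAdd
      exact hs
  have hs : g * X (.ofAdd s) * g⁻¹ = X (.ofAdd (r * s)) := DFunLike.congr_fun key (.ofAdd s)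
  rwa [mul_inv_eq_iff_eq_mul] at hs

end TorusElement

/-! ### The canonical metaplectic extension has tame commutators -/

section Assembly

open LieAlgebra LieAlgebra.IsKilling

variable {F : Type*} [Field F] [CharZero F] {L : Type*} [LieRing L] [LieAlgebra F L]
  [IsKilling F L] [FiniteDimensional F L] {H : LieSubalgebra F L} [H.IsCartanSubalgebra]
  [LieModule.IsTriangularizable F H L] {V : Type*} [AddCommGroup V] [Module F V]
  [FiniteDimensional F V] [LieRingModule L V] [LieModule F L V]

open IsLocalRing in
/-- The torus of a canonical metaplectic extension for a tame Hilbert symbol. -/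
theorem IsCanonicalExtension.exists_tameCommutators {m : ℕ} [NeZero m] {O : ValuationSubring F}
    [IsDiscreteValuationRing O] [Finite (ResidueField O)] [HenselianRing O (maximalIdeal O)]
    {ξ : F} (hξ : IsPrimitiveRoot ξ m) (hm : IsUnit (m : O))
    (hsc : IsSimplyConnectedRep H V) {c : Fˣ → Fˣ → rootsOfUnity m F}
    (hc : IsHilbertSymbol O m c) {E : Type*} [Group E]
    {S : GroupExtension (rootsOfUnity m F) E (chevalleyGroup H V)}
    (hS : IsCanonicalExtension H S c) :
    ∃ (a : {α : H.root // IsLongRoot H α} → Fˣ → E) (ϖ u₀ : Fˣ),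
      TameCommutators S.rightHom (chevalleyTorus H V ⊤) (chevalleyTorus H V O.unitGroup) a
        O.unitGroup (fun t u => S.inl (c t u))
        (fun α β => (rootSystem H).pairingIn ℤ α.1 β.1) m ϖ u₀ := by
  have hcen : S.rightHom.ker ≤ Subgroup.center E := S.range_inl_eq_ker_rightHom ▸ hS.central
  have hexp : ∀ z ∈ S.rightHom.ker, z ^ m = 1 := by
    intro z hz
    rw [← S.range_inl_eq_ker_rightHom] at hz
    obtain ⟨x, rfl⟩ := hz
    rw [← map_pow, show x ^ m = 1 from Subtype.ext x.2, map_one]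
  have hsurj := S.rightHom_surjective
  have hm0 := NeZero.ne m
  let R : ∀ α : H.root, RootTriple α := fun α => Classical.arbitrary _
  choose X hX using fun α => exists_lift_of_divisible hm0 hcen hexp hsurj ((R α).upper V)
  choose Y hY using fun α => exists_lift_of_divisible hm0 hcen hexp hsurj ((R α).lower V)
  have hXc (α) : S.rightHom.comp (X α) = (R α).upper V := MonoidHom.ext (hX α)
  have hYc (α) : S.rightHom.comp (Y α) = (R α).lower V := MonoidHom.ext (hY α)
  have ha (α : H.root) (t : Fˣ) :
      S.rightHom (torusElement (X α) (Y α) t) = (R α).cochar V t := by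
    rw [map_torusElement, hXc, hYc, RootTriple.cochar]
  obtain ⟨p, hp⟩ := IsDiscreteValuationRing.exists_irreducible O
  let ϖ : Fˣ := Units.mk0 p fun h => hp.ne_zero (Subtype.ext h)
  obtain ⟨u₀, hu₀, hdvd⟩ := hc.exists_dvd_of_zpow_eq_one hξ hm hp (ϖ := ϖ) rfl
  have hclosure (U : Subgroup Fˣ) : chevalleyTorus H V U = Subgroup.closure (S.rightHom ''
      {x | ∃ α : {α : H.root // IsLongRoot H α}, ∃ t ∈ U, x = torusElement (X α) (Y α) t}) := by
    rw [chevalleyTorus_eq_closure hsc R U]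
    congr 1
    ext g
    constructor
    · rintro ⟨α, hα, u, hu, rfl⟩
      exact ⟨_, ⟨⟨α, hα⟩, u, hu, rfl⟩, ha α u⟩
    · rintro ⟨_, ⟨α, u, hu, rfl⟩, rfl⟩
      exact ⟨α, α.2, u, hu, ha α u⟩
  refine ⟨fun α t => torusElement (X α) (Y α) t, ϖ, u₀, ?_⟩
  exact
    { surjective := hsurj
      ker_le_center := hcen
      pow_eq_one := hexp
      torus_eq := by simpa using hclosure ⊤
      units_eq := hclosure _
      map_mul := fun α t u => by rw [ha, ha, ha, RootTriple.cochar_mul]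
      symbol_mem := fun t u => by
        rw [← S.range_inl_eq_ker_rightHom]
        exact ⟨_, rfl⟩
      comm := fun α β t u => by
        -- The exponent moves into the second argument of the symbol, so that the commutator is the
        -- cocycle of `α` at `t` and `r = u ^ ⟨α, β^∨⟩`, the scalar by which `β^∨(u)` acts on the
        -- root subgroup of `α`.
        rw [← map_zpow, ← hc.zpow_right hξ]
        refine torusElement_mul_eq (r := u ^ (rootSystem H).pairingIn ℤ α.1 β.1)
          (mul_eq_mul_of_divisible hm0 hcen hexp fun s => ?_) (fun s => ?_) t ?_
        · rw [ha, hX, hX]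
          exact (R β).cochar_mul_upper (R α) u s
        · rw [← Units.val_inv_eq_inv_val, ← zpow_neg]
          refine mul_eq_mul_of_divisible hm0 hcen hexp (fun s => ?_) s
          rw [ha, hY, hY]
          exact (R β).cochar_mul_lower (R α) u s
        · refine hS.cocycle α α.2 _ _ _ (R α).triple (R α).e_mem (R α).f_mem _ _ (fun s => ?_)
            (fun s => ?_) _ _
          · rw [hX]; rfl
          · rw [hY]; rfl
      symbol_unit := fun t ht u hu => by rw [hc.apply_units hξ hm ht hu, map_one]
      exists_eq := ValuationSubring.exists_eq_zpow_mul hp rfl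
      unit_mem := hu₀
      dvd_of_zpow_eq_one := fun n hn => hdvd n <| S.inl_injective <| by
        rw [map_zpow, map_one]; exact hn
      exists_eq_mul_pow := fun u hu => by
        obtain ⟨ζ, hζ, w, h1, h2⟩ := ValuationSubring.exists_eq_mul_pow hm hu
        exact ⟨ζ, hζ, w, isOfFinOrder_iff_pow_eq_one.2
          ⟨_, Nat.pos_of_ne_zero (natCard_residueField_sub_one_ne_zero (O := O)), h1⟩, h2⟩ }

end Assembly

theorem mainTheorem9
    {k : Type*} [Field k] [NumberField k]
    (v : IsDedekindDomain.HeightOneSpectrum (𝓞 k))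
    (m : ℕ) (hroot : ∃ ζ : k, IsPrimitiveRoot ζ m) (hm : (m : 𝓞 k) ∉ v.asIdeal)
    {L : Type*} [LieRing L] [LieAlgebra (v.adicCompletion k) L]
    [FiniteDimensional (v.adicCompletion k) L]
    [LieAlgebra.HasTrivialRadical (v.adicCompletion k) L]
    (H : LieSubalgebra (v.adicCompletion k) L) [H.IsCartanSubalgebra]
    [LieModule.IsTriangularizable (v.adicCompletion k) H L]
    {V : Type*} [AddCommGroup V] [Module (v.adicCompletion k) V]
    [FiniteDimensional (v.adicCompletion k) V]
    [LieRingModule L V] [LieModule (v.adicCompletion k) L V]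
    (hsc : IsSimplyConnectedRep H V)
    (c : (v.adicCompletion k)ˣ → (v.adicCompletion k)ˣ → rootsOfUnity m (v.adicCompletion k))
    (hc : IsHilbertSymbol (v.adicCompletionIntegers k) m c)
    {E : Type*} [Group E]
    (S : GroupExtension (rootsOfUnity m (v.adicCompletion k)) E (chevalleyGroup H V))
    (hS : IsCanonicalExtension H S c) :
    ∃ A : Subgroup (chevalleyGroup H V),
      A = centreImage S.rightHom (chevalleyTorus H V ⊤) ⊔
        chevalleyTorus H V (v.adicCompletionIntegers k).unitGroup ∧
      IsMaximalIsotropic S.rightHom (chevalleyTorus H V ⊤) A ∧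
      IsTame S.rightHom (chevalleyTorus H V ⊤) A := by
  have : NeZero m := ⟨fun h => hm (by simp [h])⟩
  obtain ⟨ζ, hζ⟩ := hroot
  obtain ⟨a, ϖ, u₀, h⟩ := hS.exists_tameCommutators
    (hζ.map_of_injective (algebraMap k (v.adicCompletion k)).injective)
    (v.isUnit_natCast_adicCompletionIntegers hm) hsc hc
  exact ⟨_, rfl, h.isMaximalIsotropic, h.isTame⟩
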